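/- Let $x,y\ge 0$ be integers, $N=x+y$ and $[N]=\{1,\dots,N\}$. Let $K$ be a field in which $2\neq 0$, let $X,Y\in K$, let $k\in\mathbb Z$, and let $q\in K$ be nonzero with $q^{2i}\neq 1$ for $1\le i\le y-1$ (so that all denominators below are nonzero; for example $q$ is an indeterminate). Write $$\langle n\rangle_q=\frac{q^n-q^{-n}}{q-q^{-1}},\qquad \langle n\rangle_q!=\langle 1\rangle_q\langle 2\rangle_q\cdots\langle n\rangle_q,\qquad \langle n\rangle_q^+=\frac{q^n+q^{-n}}{2}.$$ Consider the triangular lattice with vertical lattice lines, and let $S_{x,y}$ be the trapezoid on it with sides of length $x$, $y$, $x+y$, $y$ clockwise from the left side (the sides of lengths $x$ and $x+y$ are vertical). The unit segments on its right side are numbered $1,2,\dots,N$ from the bottom to the top, and the $m$-th one is given the label $m-\frac{x+y+1}{2}$. For $W\subseteq[N]$, let $S_{x,y}(\overline W)$ be the region obtained from $S_{x,y}$ by deleting the left-pointing unit triangles whose right sides are the segments numbered by the elements of $W$. For a set $Z$ of labels, let $S_{x,y}(Z)$ be the region obtained by deleting the left-pointing unit triangles whose right sides have labels in $Z$; thus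 $S_{x,y}(\overline W)=S_{x,y}\left(W-\frac{x+y+1}{2}\right)$. Place the region so that the line $i=k$ is the (horizontal) perpendicular bisector of the left side of $S_{x,y}$, where $i$ is the vertical coordinate, measured in halves of the side length of a unit triangle. A horizontal lozenge (one whose long diagonal is horizontal) whose center has $i$-coordinate $n$ has weight $\frac{Xq^n+Yq^{-n}}{2}$; every other lozenge has weight $1$. The weight of a lozenge tiling is the product of the weights of its lozenges, and $\operatorname{M}_{(q,X,Y,k)}(R)$ is the sum of the weights of all lozenge tilings of $R$. **Theorem.** Let $W\subseteq[N]$. If $y\ge1$ and $|W|\neq y$, then $S_{x,y}(\overline W)$ has no lozenge tiling, and hence $\operatorname{M}_{(q,X,Y,k)}(S_{x,y}(\overline W))=0$. If $|W|=y$ (where $y=0$ is allowed), then $$\operatorname{M}_{(q,X,Y,k)}(S_{x,y}(\overline W))=\frac{\Delta_{1,1,(q,X,Y,k)}(W)}{\prod_{i=1}^{y-1}\langle i\rangle_q!},$$ where $$\Delta_{1,1,(q,X,Y,k)}(W)=\prod_{\substack{w_1,w_2\in W\\ w_1<w_2}}\frac{X\,q^{(w_1+w_2+k)-(x+y+1)}+Y\,q^{-[(w_1+w_2+k)-(x+y+1)]}}{2}\,\langle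 w_2-w_1\rangle_q .$$ In particular (the special case $X=Y=1$, $k=0$), let $Z\subseteq\left\{-\frac{x+y-1}{2},-\frac{x+y-3}{2},\dots,\frac{x+y-1}{2}\right\}$. If $y\ge1$ and $|Z|\neq y$, then $S_{x,y}(Z)$ has no lozenge tiling and $\operatorname{M}_{(q,1,1,0)}(S_{x,y}(Z))=0$. If $|Z|=y$, then $$\operatorname{M}_{(q,1,1,0)}(S_{x,y}(Z))=\frac{\prod_{z_1,z_2\in Z,\ z_1<z_2}\langle z_2+z_1\rangle_q^+\,\langle z_2-z_1\rangle_q}{\prod_{i=1}^{y-1}\langle i\rangle_q!}.$$ -/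

import Mathlib

/-- A unit triangle of the triangular lattice with vertical lattice lines. Points of the plane are
written `(j, i)`: `j` is the number of the vertical lattice line (strips have width `1`), and `i` is
the vertical coordinate, measured in halves of the side length of a unit triangle.
`left j i` is the left-pointing and `right j i` the right-pointing unit triangle whose vertical side
lies on line `j` and is centred at `(j, i)`. -/
inductive UnitTriangle where
  | left (j i : ℤ) : UnitTriangle
  | right (j i : ℤ) : UnitTriangle
deriving DecidableEq

/-- A unit lozenge: the union of two unit triangles that share a side, sorted by the slope of the
long diagonal. `horizontal j i` has its centre at `(j, i)`; `positive j i` and `negative j i` lie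
in the strip between the lines `j` and `j + 1`, and their left-pointing half is `left (j + 1) i`. -/
inductive Lozenge where
  | horizontal (j i : ℤ) : Lozenge
  | positive (j i : ℤ) : Lozenge
  | negative (j i : ℤ) : Lozenge
deriving DecidableEq

/-- The vertices of a unit triangle, as points `(j, i)`. -/
def UnitTriangle.vertices : UnitTriangle → Finset (ℤ × ℤ)
  | .left j i => {(j, i - 1), (j, i + 1), (j - 1, i)}
  | .right j i => {(j, i - 1), (j, i + 1), (j + 1, i)}

/-- The left-pointing half of a lozenge. -/
def Lozenge.leftHalf : Lozenge → UnitTriangle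
  | .horizontal j i => .left j i
  | .positive j i => .left (j + 1) i
  | .negative j i => .left (j + 1) i

/-- The right-pointing half of a lozenge. -/
def Lozenge.rightHalf : Lozenge → UnitTriangle
  | .horizontal j i => .right j i
  | .positive j i => .right j (i - 1)
  | .negative j i => .right j (i + 1)

/-- The two unit triangles that make up a lozenge. -/
def Lozenge.triangles (l : Lozenge) : Finset UnitTriangle :=
  {l.leftHalf, l.rightHalf}

/-- Lozenges are exactly the pairs of a left-pointing and a right-pointing unit triangle that have a
side (that is, two vertices) in common. -/
theorem UnitTriangle.share_side_iff (j i j' i' : ℤ) :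
    ((UnitTriangle.left j i).vertices ∩ (UnitTriangle.right j' i').vertices).card = 2 ↔
      ∃ l : Lozenge, l.leftHalf = .left j i ∧ l.rightHalf = .right j' i' := by
  have h1 : (UnitTriangle.left j i).vertices ∩ (UnitTriangle.right j' i').vertices =
      (UnitTriangle.left j i).vertices.filter fun v => v ∈ (UnitTriangle.right j' i').vertices :=
    (Finset.filter_mem_eq_inter).symm
  have h2 : (∃ l : Lozenge, l.leftHalf = .left j i ∧ l.rightHalf = .right j' i') ↔
      (j' = j ∧ i' = i) ∨ (j' = j - 1 ∧ i' = i - 1) ∨ (j' = j - 1 ∧ i' = i + 1) := by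
    constructor
    · rintro ⟨l, hl, hr⟩
      cases l <;> simp only [Lozenge.leftHalf, Lozenge.rightHalf, UnitTriangle.left.injEq,
        UnitTriangle.right.injEq] at hl hr <;> omega
    · rintro (⟨rfl, rfl⟩ | ⟨rfl, rfl⟩ | ⟨rfl, rfl⟩)
      · exact ⟨.horizontal _ _, rfl, rfl⟩
      · exact ⟨.positive (j - 1) i, by simp [Lozenge.leftHalf], rfl⟩
      · exact ⟨.negative (j - 1) i, by simp [Lozenge.leftHalf], rfl⟩
  have h3 : ({(j, i - 1), (j, i + 1)} : Finset (ℤ × ℤ)).card = 2 :=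
    Finset.card_pair (by simp only [ne_eq, Prod.mk.injEq]; omega)
  rw [h1, h2]
  simp only [UnitTriangle.vertices, Finset.filter_insert, Finset.filter_singleton,
    Finset.mem_insert, Finset.mem_singleton, Prod.mk.injEq]
  split_ifs <;> (try simp [Finset.card_insert_of_notMem]) <;> omega

/-- `T` is a lozenge tiling of the region `R` (a finite set of unit triangles): the lozenges of `T`
are contained in `R`, and every unit triangle of `R` is covered by exactly one of them. -/
def IsLozengeTiling (R : Finset UnitTriangle) (T : Finset Lozenge) : Prop :=
  (∀ l ∈ T, l.triangles ⊆ R) ∧ ∀ t ∈ R, (T.filter fun l => t ∈ l.triangles).card = 1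

instance (R : Finset UnitTriangle) (T : Finset Lozenge) : Decidable (IsLozengeTiling R T) := by
  unfold IsLozengeTiling
  infer_instance

/-- The lozenges that have a given unit triangle as their left-pointing half. -/
def lozengesWithLeftHalf : UnitTriangle → Finset Lozenge
  | .left j i => {.horizontal j i, .positive (j - 1) i, .negative (j - 1) i}
  | .right _ _ => ∅

/-- The finite set of all lozenges contained in the region `R`. -/
def lozengesIn (R : Finset UnitTriangle) : Finset Lozenge :=
  (R.biUnion lozengesWithLeftHalf).filter fun l => l.triangles ⊆ R

/-- The finite set of all lozenge tilings of the region `R`. -/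
def lozengeTilings (R : Finset UnitTriangle) : Finset (Finset Lozenge) :=
  (lozengesIn R).powerset.filter fun T => IsLozengeTiling R T

theorem mem_lozengeTilings (R : Finset UnitTriangle) (T : Finset Lozenge) :
    T ∈ lozengeTilings R ↔ IsLozengeTiling R T := by
  unfold lozengeTilings
  rw [Finset.mem_filter, Finset.mem_powerset]
  refine ⟨fun h => h.2, fun h => ⟨fun l hl => ?_, h⟩⟩
  have hsub := h.1 l hl
  unfold lozengesIn
  rw [Finset.mem_filter, Finset.mem_biUnion]
  refine ⟨⟨l.leftHalf, hsub (by simp [Lozenge.triangles]), ?_⟩, hsub⟩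
  cases l <;> simp [Lozenge.leftHalf, lozengesWithLeftHalf]

/-- The weight of a lozenge: `(X q ^ n + Y q ^ (-n)) / 2` for a horizontal lozenge whose centre has
`i`-coordinate `n`, and `1` for every other lozenge. -/
def lozengeWeight {K : Type*} [Field K] (q X Y : K) : Lozenge → K
  | .horizontal _ n => (X * q ^ n + Y * q ^ (-n)) / 2
  | .positive _ _ => 1
  | .negative _ _ => 1

/-- The tiling generating function of the region `R`: the sum over all lozenge tilings of `R` of the
product of the weights of the lozenges of the tiling. -/
def tilingGF {K : Type*} [Field K] (q X Y : K) (R : Finset UnitTriangle) : K :=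
  ∑ T ∈ lozengeTilings R, ∏ l ∈ T, lozengeWeight q X Y l

/-- The `i`-coordinate of the centre of the `m`-th unit segment from the bottom (`m = 1, 2, …, N`) on
a vertical segment of length `N` whose perpendicular bisector is the line `i = k`. -/
def segmentCentre (k : ℤ) (N m : ℕ) : ℤ :=
  k + 2 * (m : ℤ) - ((N : ℤ) + 1)

/-- The trapezoid with sides of length `x`, `y`, `x + y`, `y` clockwise from the left, with vertical
left and right sides on the lines `j = 0` and `j = y`, placed so that the line `i = k` is the
perpendicular bisector of its left side. It meets the line `j` (`0 ≤ j ≤ y`) in a vertical segment of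
length `x + j`. -/
def trapezoid (x y : ℕ) (k : ℤ) : Finset UnitTriangle :=
  ((Finset.Icc 1 y).biUnion fun j =>
      (Finset.Icc 1 (x + j)).image fun m => .left (j : ℤ) (segmentCentre k (x + j) m)) ∪
    ((Finset.range y).biUnion fun j =>
      (Finset.Icc 1 (x + j)).image fun m => .right (j : ℤ) (segmentCentre k (x + j) m))

/-- The unit triangles of the trapezoid are the lattice triangles contained in it: those all of whose
vertices `(j, i)` are lattice points with `0 ≤ j ≤ y` and `|i - k| ≤ x + j`. -/
theorem mem_trapezoid_iff (x y : ℕ) (k : ℤ) (t : UnitTriangle) :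
    t ∈ trapezoid x y k ↔ ∀ v ∈ t.vertices,
      0 ≤ v.1 ∧ v.1 ≤ y ∧ |v.2 - k| ≤ x + v.1 ∧ Even (v.2 - k + x + v.1) := by
  cases t with
  | left j i =>
    simp only [trapezoid, segmentCentre, UnitTriangle.vertices, Finset.mem_union,
      Finset.mem_biUnion, Finset.mem_image, Finset.mem_Icc, Finset.mem_range,
      UnitTriangle.left.injEq, reduceCtorEq, and_false, exists_false, or_false,
      Finset.mem_insert, Finset.mem_singleton, forall_eq_or_imp, forall_eq, abs_le,
      Int.even_iff]
    constructor
    · rintro ⟨a, ha, m, hm, rfl, rfl⟩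
      push_cast
      omega
    · intro h
      refine ⟨j.toNat, by omega, ((i - k + x + j + 1) / 2).toNat, by omega, by omega, ?_⟩
      push_cast
      omega
  | right j i =>
    simp only [trapezoid, segmentCentre, UnitTriangle.vertices, Finset.mem_union,
      Finset.mem_biUnion, Finset.mem_image, Finset.mem_Icc, Finset.mem_range,
      UnitTriangle.right.injEq, reduceCtorEq, and_false, exists_false, false_or,
      Finset.mem_insert, Finset.mem_singleton, forall_eq_or_imp, forall_eq, abs_le,
      Int.even_iff]
    constructor
    · rintro ⟨a, ha, m, hm, rfl, rfl⟩
      push_cast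
      omega
    · intro h
      refine ⟨j.toNat, by omega, ((i - k + x + j + 1) / 2).toNat, by omega, by omega, ?_⟩
      push_cast
      omega

/-- The label of the `m`-th unit segment from the bottom on the right side of the trapezoid:
the labels are `-(x + y - 1) / 2, -(x + y - 3) / 2, …, (x + y - 1) / 2` from the bottom to the top. -/
def sideLabel (x y m : ℕ) : ℚ :=
  (m : ℚ) - ((x : ℚ) + (y : ℚ) + 1) / 2

/-- The set of all labels of unit segments on the right side of the trapezoid. -/
def sideLabels (x y : ℕ) : Finset ℚ :=
  (Finset.Icc 1 (x + y)).image (sideLabel x y)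

/-- The region obtained from the trapezoid by deleting the left-pointing unit triangles whose right
sides have their labels in `Z`. -/
def dentedTrapezoid (x y : ℕ) (k : ℤ) (Z : Finset ℚ) : Finset UnitTriangle :=
  trapezoid x y k \
    ((Finset.Icc 1 (x + y)).filter fun m => sideLabel x y m ∈ Z).image
      fun m => .left (y : ℤ) (segmentCentre k (x + y) m)

/-- The region obtained from the trapezoid by deleting the left-pointing unit triangles whose right
sides are labelled by the elements of `W - (x + y + 1) / 2`. -/
def dentedTrapezoidBar (x y : ℕ) (k : ℤ) (W : Finset ℕ) : Finset UnitTriangle :=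
  dentedTrapezoid x y k (W.image (sideLabel x y))

/-- The `q`-integer `⟨n⟩_q = (q ^ n - q ^ (-n)) / (q - q⁻¹)`. -/
def qInt {K : Type*} [Field K] (q : K) (n : ℤ) : K :=
  (q ^ n - q ^ (-n)) / (q - q⁻¹)

/-- The `q`-factorial `⟨n⟩_q! = ⟨1⟩_q ⟨2⟩_q ⋯ ⟨n⟩_q`. -/
def qFact {K : Type*} [Field K] (q : K) (n : ℕ) : K :=
  ∏ i ∈ Finset.Icc 1 n, qInt q i

/-- `⟨n⟩_q⁺ = (q ^ n + q ^ (-n)) / 2`. -/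
def qPlus {K : Type*} [Field K] (q : K) (n : ℤ) : K :=
  (q ^ n + q ^ (-n)) / 2

/-- The product over all pairs `w₁ < w₂` in `W` of
`(X q ^ n + Y q ^ (-n)) / 2 * ⟨w₂ - w₁⟩_q`, where `n = w₁ + w₂ + k - (x + y + 1)`. -/
def DeltaXY {K : Type*} [Field K] (q X Y : K) (k : ℤ) (x y : ℕ) (W : Finset ℕ) : K :=
  ∏ p ∈ (W ×ˢ W).filter fun p => p.1 < p.2,
    (X * q ^ (((p.1 : ℤ) + (p.2 : ℤ) + k) - ((x : ℤ) + (y : ℤ) + 1)) +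
        Y * q ^ (-(((p.1 : ℤ) + (p.2 : ℤ) + k) - ((x : ℤ) + (y : ℤ) + 1)))) / 2 *
      qInt q ((p.2 : ℤ) - (p.1 : ℤ))

/-- The product over all pairs `z₁ < z₂` in `Z` of `⟨z₂ + z₁⟩_q⁺ ⟨z₂ - z₁⟩_q`, for a finite set `Z`
of integers or a finite set `Z` of halves of odd integers. In both cases `z₂ + z₁` and `z₂ - z₁` are
integers, and the floor only turns these rational numbers into elements of `ℤ`. -/
def Delta {K : Type*} [Field K] (q : K) (Z : Finset ℚ) : K :=
  ∏ p ∈ (Z ×ˢ Z).filter fun p => p.1 < p.2, qPlus q ⌊p.2 + p.1⌋ * qInt q ⌊p.2 - p.1⌋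

/-!
A tiling is read off from its horizontal lozenges. On the vertical line `j` of the trapezoid let
`V_j` be the set of positions of the horizontal lozenges centred on that line, with `V_y = W` the
set of dents. The strip between two consecutive lines is then a chain of unit triangles, alternately
left- and right-pointing, from which the triangles at `V_j` and `V_{j+1}` have been removed. Such a
chain has at most one tiling, and it has one exactly when `V_j` interlaces with `V_{j+1}`
(`tilingGF_stripRegion`); in particular `V_{j+1}` has one element more than `V_j`. Cutting the
trapezoid along its last inner line (`tilingGF_eq_sum_powerset`) therefore gives a branching rule
for the generating function (`tilingGF_dentedTrapezoidBar_succ`), and tilings can exist only if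
`W` has `y` elements.

The product `DeltaXY` is a Vandermonde determinant in the values of the function
`qSinh t = (X q ^ t - Y q ^ (-t)) / (2 (q - q⁻¹))` (`DeltaXY_image_eq_det_vandermonde`), and the
weight of a horizontal lozenge at height `t` is the central difference
`qSinh (t + 1) - qSinh (t - 1)`. More generally `qSinh (t + 1) ^ (n + 1) - qSinh (t - 1) ^ (n + 1)`
is this weight times a polynomial in `qSinh t` of degree `n` with leading coefficient `⟨n + 1⟩_q`,
because the sum of
`qSinh (t + 1)` and `qSinh (t - 1)` is `(q + q⁻¹) qSinh t` and their product differs from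
`qSinh t ^ 2` by a constant. Subtracting consecutive rows of the Vandermonde matrix, telescoping the
differences and expanding in the rows shows that the determinant obeys the branching rule of the
tilings up to a factor `⟨n⟩_q!` (`det_vandermonde_qSinh_eq_sum`). The theorem follows by
induction on `y`.
-/

/-! ### The functions `(X q ^ t ± Y q ^ (-t)) / 2` -/

/-- The deformed hyperbolic cosine `(X q ^ t + Y q ^ (-t)) / 2`: the weight of a horizontal lozenge
centred at height `t`. -/
def qCosh {K : Type*} [Field K] (q X Y : K) (t : ℤ) : K :=
  (X * q ^ t + Y * q ^ (-t)) / 2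

/-- The deformed hyperbolic sine, normalised so that its central difference of step `1` is
`qCosh`. -/
def qSinh {K : Type*} [Field K] (q X Y : K) (t : ℤ) : K :=
  (X * q ^ t - Y * q ^ (-t)) / (2 * (q - q⁻¹))

section qSinh

variable {K : Type*} [Field K] {q : K}

theorem qSinh_add_sub_qSinh_sub (hq0 : q ≠ 0) (X Y : K) (m n : ℤ) :
    qSinh q X Y (m + n) - qSinh q X Y (m - n) = qCosh q X Y m * qInt q n := by
  have hm : q ^ m ≠ 0 := zpow_ne_zero _ hq0
  have hn : q ^ n ≠ 0 := zpow_ne_zero _ hq0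
  have e : -(m - n) = n - m := by ring
  have e' : -(m + n) = -m + -n := by ring
  unfold qSinh qCosh qInt
  rw [e, e', ← sub_div, div_mul_div_comm]
  congr 1
  simp only [zpow_add₀ hq0, zpow_sub₀ hq0, zpow_neg]
  field_simp
  ring

theorem qInt_one (hq : q - q⁻¹ ≠ 0) : qInt q 1 = 1 := by
  simp [qInt, div_self hq]

theorem qInt_two (hq : q - q⁻¹ ≠ 0) : qInt q 2 = q + q⁻¹ := by
  rw [qInt, div_eq_iff hq, zpow_neg]
  norm_cast
  rw [← inv_pow]
  ring

theorem qInt_add_two (hq0 : q ≠ 0) (n : ℤ) :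
    qInt q (n + 2) = (q + q⁻¹) * qInt q (n + 1) - qInt q n := by
  have hn : q ^ n ≠ 0 := zpow_ne_zero _ hq0
  unfold qInt
  rw [← mul_div_assoc, ← sub_div]
  congr 1
  simp only [zpow_add₀ hq0, zpow_neg, zpow_one, show q ^ (2 : ℤ) = q ^ 2 from by norm_cast]
  field_simp
  ring

theorem qInt_ne_zero (hq0 : q ≠ 0) (hq : q - q⁻¹ ≠ 0) {n : ℕ} (hn : q ^ (2 * n) ≠ 1) :
    qInt q n ≠ 0 := by
  unfold qInt
  refine div_ne_zero (fun h => hn ?_) hq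
  have h' : q ^ n = (q ^ n)⁻¹ := by simpa [sub_eq_zero] using h
  rw [two_mul, pow_add]
  nth_rewrite 2 [h']
  exact mul_inv_cancel₀ (pow_ne_zero _ hq0)

theorem qSinh_succ_sub_qSinh_pred (hq0 : q ≠ 0) (hq : q - q⁻¹ ≠ 0) (X Y : K) (t : ℤ) :
    qSinh q X Y (t + 1) - qSinh q X Y (t - 1) = qCosh q X Y t := by
  rw [qSinh_add_sub_qSinh_sub hq0, qInt_one hq, mul_one]

theorem qSinh_succ_add_qSinh_pred (hq0 : q ≠ 0) (X Y : K) (t : ℤ) :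
    qSinh q X Y (t + 1) + qSinh q X Y (t - 1) = (q + q⁻¹) * qSinh q X Y t := by
  have ht : q ^ t ≠ 0 := zpow_ne_zero _ hq0
  unfold qSinh
  rw [← add_div, ← mul_div_assoc]
  congr 1
  simp only [neg_add, sub_eq_add_neg, neg_neg, zpow_add₀ hq0, zpow_neg, zpow_one]
  ring

theorem qSinh_succ_mul_qSinh_pred (hq0 : q ≠ 0) (hq : q - q⁻¹ ≠ 0) (X Y : K)
    (t : ℤ) :
    qSinh q X Y (t + 1) * qSinh q X Y (t - 1) = qSinh q X Y t ^ 2 + -(X * Y / 4) := by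
  have ht : q ^ t ≠ 0 := zpow_ne_zero _ hq0
  have h4 : X * Y / 4 = X * Y * (q - q⁻¹) ^ 2 / (2 * (q - q⁻¹)) ^ 2 := by
    rw [mul_pow, mul_div_mul_right _ _ (pow_ne_zero 2 hq)]
    norm_num
  rw [h4]
  unfold qSinh
  rw [div_mul_div_comm, div_pow, ← neg_div, ← add_div, ← sq]
  congr 1
  simp only [neg_add, sub_eq_add_neg, neg_neg, zpow_add₀ hq0, zpow_neg, zpow_one]
  field_simp
  ring

end qSinh

/-! ### Differences of powers as polynomials -/

open Polynomial in
/-- The polynomials `P n` with `A ^ (n + 1) - B ^ (n + 1) = (A - B) * P n (F)` whenever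
`A + B = (q + q⁻¹) * F` and `A * B = F ^ 2 + d`. The recursion is that of the complete homogeneous
symmetric polynomials in `A` and `B`, written in terms of `A + B` and `A * B`. -/
noncomputable def diffPoly {K : Type*} [Field K] (q d : K) : ℕ → K[X]
  | 0 => 1
  | 1 => C (q + q⁻¹) * X
  | n + 2 => C (q + q⁻¹) * X * diffPoly q d (n + 1) - (X ^ 2 + C d) * diffPoly q d n

section diffPoly

variable {K : Type*} [Field K] {q : K}

theorem pow_succ_sub_pow_succ_eq_diffPoly {d A B F : K} (hadd : A + B = (q + q⁻¹) * F)
    (hmul : A * B = F ^ 2 + d) (n : ℕ) :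
    A ^ (n + 1) - B ^ (n + 1) = (A - B) * (diffPoly q d n).eval F := by
  induction n using Nat.twoStepInduction with
  | zero => simp [diffPoly]
  | one => simp [diffPoly, ← hadd]; ring
  | more n ih0 ih1 =>
    simp only [diffPoly, Polynomial.eval_sub, Polynomial.eval_mul, Polynomial.eval_C,
      Polynomial.eval_X, Polynomial.eval_add, Polynomial.eval_pow, ← hadd, ← hmul]
    linear_combination (A + B) * ih1 - A * B * ih0

theorem natDegree_diffPoly_le (q d : K) (n : ℕ) : (diffPoly q d n).natDegree ≤ n := by
  induction n using Nat.twoStepInduction with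
  | zero => simp [diffPoly]
  | one => exact (Polynomial.natDegree_C_mul_le _ _).trans Polynomial.natDegree_X_le
  | more n ih0 ih1 =>
    refine (Polynomial.natDegree_sub_le _ _).trans (max_le ?_ ?_)
    · refine Polynomial.natDegree_mul_le.trans ?_
      have : (Polynomial.C (q + q⁻¹) * Polynomial.X).natDegree ≤ 1 :=
        (Polynomial.natDegree_C_mul_le _ _).trans Polynomial.natDegree_X_le
      omega
    · refine Polynomial.natDegree_mul_le.trans ?_
      have := Polynomial.natDegree_X_pow_add_C (n := 2) (r := d)
      omega

theorem coeff_diffPoly (hq0 : q ≠ 0) (hq : q - q⁻¹ ≠ 0) (d : K) (n : ℕ) :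
    (diffPoly q d n).coeff n = qInt q (n + 1) := by
  induction n using Nat.twoStepInduction with
  | zero => simp [diffPoly, qInt_one hq]
  | one => simp [diffPoly, ← qInt_two hq]
  | more n ih0 ih1 =>
    have h0 : (diffPoly q d n).coeff (n + 2) = 0 :=
      Polynomial.coeff_eq_zero_of_natDegree_lt ((natDegree_diffPoly_le q d n).trans_lt (by omega))
    rw [diffPoly, Polynomial.coeff_sub, mul_assoc, Polynomial.coeff_C_mul,
      add_mul (Polynomial.X ^ 2), Polynomial.coeff_add, Polynomial.coeff_C_mul, h0,
      Polynomial.coeff_X_mul, Polynomial.coeff_X_pow_mul, ih0, ih1]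
    have := qInt_add_two hq0 (n + 1)
    push_cast
    rw [show (n : ℤ) + 2 + 1 = n + 1 + 2 by ring, this]
    ring

end diffPoly

/-! ### The branching rule for Vandermonde determinants -/

theorem det_eval_polynomial_eq_prod_coeff_mul_det_vandermonde {R : Type*} [CommRing R] {n : ℕ}
    (v : Fin n → R) (p : Fin n → Polynomial R) (hp : ∀ i, (p i).natDegree ≤ i) :
    (Matrix.of fun i j => (p j).eval (v i)).det =
      (∏ i, (p i).coeff i) * (Matrix.vandermonde v).det := by
  rw [Matrix.eval_matrixOfPolynomials_eq_vandermonde_mul_matrixOfPolynomials v p hp,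
    Matrix.det_mul, mul_comm,
    Matrix.det_of_isUpperTriangular (Matrix.matrixOfPolynomials_blockTriangular p hp)]
  rfl

/-- Subtracting consecutive rows of a Vandermonde matrix removes its first row and column. -/
theorem det_vandermonde_eq_det_sub {R : Type*} [CommRing R] {n : ℕ} (v : Fin (n + 1) → R) :
    (Matrix.vandermonde v).det =
      (Matrix.of fun i j : Fin n =>
        v i.succ ^ ((j : ℕ) + 1) - v i.castSucc ^ ((j : ℕ) + 1)).det := by
  rw [Matrix.det_eq_of_forall_row_eq_smul_add_pred (B := Matrix.of fun i j : Fin (n + 1) =>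
      Fin.cases (v 0 ^ (j : ℕ)) (fun i => v i.succ ^ (j : ℕ) - v i.castSucc ^ (j : ℕ)) i)
    (fun _ => 1) (fun j => by simp [Matrix.vandermonde_apply])
    (fun i j => by simp [Matrix.vandermonde_apply]), Matrix.det_succ_column_zero,
    Fin.sum_univ_succ, Finset.sum_eq_zero (fun i _ => by simp)]
  simp only [Fin.val_zero, pow_zero, Matrix.of_apply, Fin.cases_zero, mul_one, one_mul, add_zero]
  congr 1

/-- The branching rule. Each entry of the row-differenced Vandermonde matrix telescopes over an
interval `[w i, w (i + 1))`, and each summand is `qCosh` times a polynomial in `qSinh`, both at the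
midpoint of the step; the polynomial in column `j` has degree at most `j`. Expanding the determinant
in its rows gives a sum over all sequences interlacing with `w`. -/
theorem det_vandermonde_qSinh_eq_sum {K : Type*} [Field K] {q : K}
    (hq0 : q ≠ 0) (hq : q - q⁻¹ ≠ 0) (X Y : K) (e : ℤ) {n : ℕ} (w : Fin (n + 1) → ℕ)
    (hw : Monotone w) :
    (Matrix.vandermonde fun i => qSinh q X Y (2 * w i + e)).det =
      ∑ u ∈ Fintype.piFinset fun i : Fin n => Finset.Ico (w i.castSucc) (w i.succ),
        (∏ i, qCosh q X Y (2 * u i + (e + 1))) * (qFact q n *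
          (Matrix.vandermonde fun i => qSinh q X Y (2 * u i + (e + 1))).det) := by
  set P : ℕ → Polynomial K := diffPoly q (-(X * Y / 4)) with hP
  have hstep (m j : ℕ) : qSinh q X Y (2 * (m + 1 : ℕ) + e) ^ (j + 1) -
      qSinh q X Y (2 * m + e) ^ (j + 1) =
      qCosh q X Y (2 * m + (e + 1)) * (P j).eval (qSinh q X Y (2 * m + (e + 1))) := by
    have h := pow_succ_sub_pow_succ_eq_diffPoly
      (qSinh_succ_add_qSinh_pred hq0 X Y (2 * m + (e + 1)))
      (qSinh_succ_mul_qSinh_pred hq0 hq X Y (2 * m + (e + 1))) j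
    rw [qSinh_succ_sub_qSinh_pred hq0 hq] at h
    rw [← h]
    congr 3 <;> push_cast <;> ring_nf
  have hrow (i : Fin n) (j : Fin n) :
      qSinh q X Y (2 * w i.succ + e) ^ ((j : ℕ) + 1) -
        qSinh q X Y (2 * w i.castSucc + e) ^ ((j : ℕ) + 1) =
      ∑ m ∈ Finset.Ico (w i.castSucc) (w i.succ),
        qCosh q X Y (2 * m + (e + 1)) * (P j).eval (qSinh q X Y (2 * m + (e + 1))) := by
    simp only [← hstep]
    rw [Finset.sum_Ico_sub (fun m : ℕ => qSinh q X Y (2 * m + e) ^ ((j : ℕ) + 1))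
      (hw (Fin.castSucc_le_succ i))]
  rw [det_vandermonde_eq_det_sub]
  have hM : (Matrix.of fun i j : Fin n => qSinh q X Y (2 * w i.succ + e) ^ ((j : ℕ) + 1) -
        qSinh q X Y (2 * w i.castSucc + e) ^ ((j : ℕ) + 1)) =
      fun i => ∑ m ∈ Finset.Ico (w i.castSucc) (w i.succ),
        qCosh q X Y (2 * m + (e + 1)) •
          fun j : Fin n => (P j).eval (qSinh q X Y (2 * m + (e + 1))) := by
    ext i j
    rw [Matrix.of_apply, hrow, Finset.sum_apply]
    rfl
  rw [hM]
  refine ((Matrix.detRowAlternating (n := Fin n) (R := K)).toMultilinearMap.map_sum_finset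
    (fun i (m : ℕ) => qCosh q X Y (2 * m + (e + 1)) •
      fun j : Fin n => (P j).eval (qSinh q X Y (2 * m + (e + 1)))) _).trans ?_
  refine Finset.sum_congr rfl fun u _ => ?_
  rw [MultilinearMap.map_smul_univ, smul_eq_mul]
  congr 1
  refine (det_eval_polynomial_eq_prod_coeff_mul_det_vandermonde
    (fun i => qSinh q X Y (2 * u i + (e + 1))) (fun j => P j)
    (fun j => natDegree_diffPoly_le _ _ _)).trans ?_
  congr 1
  simp only [hP, coeff_diffPoly hq0 hq, qFact]
  rw [← Finset.prod_range (fun i => qInt q ((i : ℤ) + 1)), Finset.range_eq_Ico,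
    ← Finset.Ico_add_one_right_eq_Icc]
  simpa using Finset.prod_Ico_add' (fun i : ℕ => qInt q i) 0 n 1

/-! ### Cutting a region along a vertical lattice line -/

/-- The number of the strip between consecutive vertical lattice lines that contains a unit
triangle; strip `j` lies between the lines `j - 1` and `j`. -/
def UnitTriangle.strip : UnitTriangle → ℤ
  | .left j _ => j
  | .right j _ => j + 1

theorem Lozenge.mem_triangles {l : Lozenge} {t : UnitTriangle} :
    t ∈ l.triangles ↔ t = l.leftHalf ∨ t = l.rightHalf := by
  simp [Lozenge.triangles]

theorem Lozenge.strip_leftHalf_le (l : Lozenge) : l.leftHalf.strip ≤ l.rightHalf.strip := by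
  cases l <;> simp [Lozenge.leftHalf, Lozenge.rightHalf, UnitTriangle.strip]

theorem Lozenge.eq_horizontal_of_strip {l : Lozenge} {c : ℤ} (h1 : l.leftHalf.strip ≤ c)
    (h2 : c < l.rightHalf.strip) : ∃ i, l = .horizontal c i := by
  cases l with
  | horizontal j i =>
    simp only [Lozenge.leftHalf, Lozenge.rightHalf, UnitTriangle.strip] at h1 h2
    exact ⟨i, by congr 1; omega⟩
  | positive j i =>
    simp only [Lozenge.leftHalf, Lozenge.rightHalf, UnitTriangle.strip] at h1 h2
    omega
  | negative j i =>
    simp only [Lozenge.leftHalf, Lozenge.rightHalf, UnitTriangle.strip] at h1 h2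
    omega

theorem isLozengeTiling_iff {R : Finset UnitTriangle} {T : Finset Lozenge} :
    IsLozengeTiling R T ↔
      (∀ l ∈ T, ∀ t ∈ l.triangles, t ∈ R) ∧ ∀ t ∈ R, ∃! l, l ∈ T ∧ t ∈ l.triangles := by
  refine and_congr Iff.rfl (forall₂_congr fun t _ => ?_)
  rw [Finset.card_eq_one]
  constructor
  · rintro ⟨l, hl⟩
    simp only [Finset.ext_iff, Finset.mem_filter, Finset.mem_singleton] at hl
    exact ⟨l, (hl l).2 rfl, fun l' hl' => (hl l').1 hl'⟩
  · rintro ⟨l, hl, hu⟩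
    refine ⟨l, ?_⟩
    ext l'
    simp only [Finset.mem_filter, Finset.mem_singleton]
    exact ⟨hu l', fun h => h ▸ hl⟩

/-- A tiling restricts to a subregion that no lozenge crosses the boundary of. -/
theorem IsLozengeTiling.filter {R A : Finset UnitTriangle} {T : Finset Lozenge}
    (hT : IsLozengeTiling R T) (hA : A ⊆ R) (p : Lozenge → Prop) [DecidablePred p]
    (hp : ∀ l ∈ T, ∀ t ∈ l.triangles, p l ↔ t ∈ A) : IsLozengeTiling A (T.filter p) := by
  rw [isLozengeTiling_iff] at hT ⊢
  refine ⟨fun l hl t ht => ?_, fun t ht => ?_⟩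
  · rw [Finset.mem_filter] at hl
    exact (hp l hl.1 t ht).1 hl.2
  · obtain ⟨l, hl, hu⟩ := hT.2 t (hA ht)
    refine ⟨l, ⟨Finset.mem_filter.2 ⟨hl.1, (hp l hl.1 t hl.2).2 ht⟩, hl.2⟩, fun l' hl' => ?_⟩
    exact hu l' ⟨(Finset.mem_filter.1 hl'.1).1, hl'.2⟩

theorem IsLozengeTiling.union {A B : Finset UnitTriangle} {T U : Finset Lozenge}
    (hT : IsLozengeTiling A T) (hU : IsLozengeTiling B U) (hAB : Disjoint A B) :
    IsLozengeTiling (A ∪ B) (T ∪ U) := by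
  rw [isLozengeTiling_iff] at hT hU ⊢
  rw [Finset.disjoint_left] at hAB
  refine ⟨fun l hl t ht => ?_, fun t ht => ?_⟩
  · rcases Finset.mem_union.1 hl with hl | hl
    · exact Finset.mem_union_left _ (hT.1 l hl t ht)
    · exact Finset.mem_union_right _ (hU.1 l hl t ht)
  · rcases Finset.mem_union.1 ht with ht | ht
    · obtain ⟨l, hl, hu⟩ := hT.2 t ht
      refine ⟨l, ⟨Finset.mem_union_left _ hl.1, hl.2⟩, fun l' hl' => ?_⟩
      rcases Finset.mem_union.1 hl'.1 with h | h
      · exact hu l' ⟨h, hl'.2⟩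
      · exact absurd (hU.1 l' h t hl'.2) (hAB ht)
    · obtain ⟨l, hl, hu⟩ := hU.2 t ht
      refine ⟨l, ⟨Finset.mem_union_right _ hl.1, hl.2⟩, fun l' hl' => ?_⟩
      rcases Finset.mem_union.1 hl'.1 with h | h
      · exact absurd ht (hAB (hT.1 l' h t hl'.2))
      · exact hu l' ⟨h, hl'.2⟩

theorem isLozengeTiling_horizontal (c : ℤ) (S : Finset ℤ) :
    IsLozengeTiling (S.image (.left c) ∪ S.image (.right c)) (S.image (.horizontal c)) := by
  rw [isLozengeTiling_iff]
  simp only [Finset.mem_image, Finset.mem_union, Lozenge.mem_triangles]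
  refine ⟨?_, ?_⟩
  · rintro _ ⟨i, hi, rfl⟩ t (rfl | rfl)
    · exact .inl ⟨i, hi, rfl⟩
    · exact .inr ⟨i, hi, rfl⟩
  · rintro t (⟨i, hi, rfl⟩ | ⟨i, hi, rfl⟩)
    all_goals
      refine ⟨.horizontal c i, ⟨⟨i, hi, rfl⟩, by simp [Lozenge.leftHalf, Lozenge.rightHalf]⟩, ?_⟩
      rintro _ ⟨⟨i', hi', rfl⟩, h⟩
      simpa [Lozenge.leftHalf, Lozenge.rightHalf, eq_comm] using h

/-- The part of `R` to the left of the line `c`, without the left-pointing triangles on that line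
at the heights in `S`. -/
def leftPart (R : Finset UnitTriangle) (c : ℤ) (S : Finset ℤ) : Finset UnitTriangle :=
  R.filter (fun t => t.strip ≤ c) \ S.image (.left c)

/-- The part of `R` to the right of the line `c`, without the right-pointing triangles on that line
at the heights in `S`. -/
def rightPart (R : Finset UnitTriangle) (c : ℤ) (S : Finset ℤ) : Finset UnitTriangle :=
  R.filter (fun t => c < t.strip) \ S.image (.right c)

section Cut

variable {R : Finset UnitTriangle} {c : ℤ} {S : Finset ℤ}

theorem mem_leftPart {t : UnitTriangle} :
    t ∈ leftPart R c S ↔ (t ∈ R ∧ t.strip ≤ c) ∧ ∀ i ∈ S, .left c i ≠ t := by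
  simp [leftPart]

theorem mem_rightPart {t : UnitTriangle} :
    t ∈ rightPart R c S ↔ (t ∈ R ∧ c < t.strip) ∧ ∀ i ∈ S, .right c i ≠ t := by
  simp [rightPart]

theorem disjoint_leftPart_rightPart : Disjoint (leftPart R c S) (rightPart R c S) := by
  rw [Finset.disjoint_left]
  intro t h1 h2
  rw [mem_leftPart] at h1
  rw [mem_rightPart] at h2
  omega

theorem disjoint_parts_horizontal :
    Disjoint (leftPart R c S ∪ rightPart R c S) (S.image (.left c) ∪ S.image (.right c)) := by
  rw [Finset.disjoint_left]
  intro t h1 h2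
  simp only [Finset.mem_union, mem_leftPart, mem_rightPart, Finset.mem_image] at h1 h2
  rcases h2 with ⟨i, hi, rfl⟩ | ⟨i, hi, rfl⟩
  · rcases h1 with h1 | h1
    · exact h1.2 i hi rfl
    · simp [UnitTriangle.strip] at h1
  · rcases h1 with h1 | h1
    · simp [UnitTriangle.strip] at h1
    · exact h1.2 i hi rfl

theorem parts_union_horizontal (hS : ∀ i ∈ S, .left c i ∈ R ∧ .right c i ∈ R) :
    leftPart R c S ∪ rightPart R c S ∪ (S.image (.left c) ∪ S.image (.right c)) = R := by
  ext t
  simp only [Finset.mem_union, mem_leftPart, mem_rightPart, Finset.mem_image]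
  constructor
  · rintro ((h | h) | ⟨i, hi, rfl⟩ | ⟨i, hi, rfl⟩)
    · exact h.1.1
    · exact h.1.1
    · exact (hS i hi).1
    · exact (hS i hi).2
  · intro ht
    by_contra! hcon
    obtain ⟨⟨h1, h2⟩, h3, h4⟩ := hcon
    by_cases hs : t.strip ≤ c
    · obtain ⟨i, hi, h⟩ := h1 ⟨ht, hs⟩
      exact h3 i hi h
    · obtain ⟨i, hi, h⟩ := h2 ⟨ht, by omega⟩
      exact h4 i hi h

/-- Tilings of the two parts, together with the horizontal lozenges across the cut, tile `R`. -/
theorem IsLozengeTiling.glue (hS : ∀ i ∈ S, .left c i ∈ R ∧ .right c i ∈ R) {T U : Finset Lozenge}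
    (hT : IsLozengeTiling (leftPart R c S) T) (hU : IsLozengeTiling (rightPart R c S) U) :
    IsLozengeTiling R (T ∪ U ∪ S.image (.horizontal c)) := by
  have h := (hT.union hU disjoint_leftPart_rightPart).union (isLozengeTiling_horizontal c S)
    disjoint_parts_horizontal
  rwa [parts_union_horizontal hS] at h

theorem IsLozengeTiling.eq_of_mem {T : Finset Lozenge} (hT : IsLozengeTiling R T)
    {l l' : Lozenge} (hl : l ∈ T) (hl' : l' ∈ T) {t : UnitTriangle} (ht : t ∈ l.triangles)
    (ht' : t ∈ l'.triangles) : l = l' := by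
  rw [isLozengeTiling_iff] at hT
  exact (hT.2 t (hT.1 l hl t ht)).unique ⟨hl, ht⟩ ⟨hl', ht'⟩

theorem IsLozengeTiling.filter_leftPart {T : Finset Lozenge} (hT : IsLozengeTiling R T)
    (hS : ∀ i, i ∈ S ↔ .horizontal c i ∈ T) :
    IsLozengeTiling (leftPart R c S) (T.filter fun l => l.rightHalf.strip ≤ c) := by
  refine hT.filter (fun t ht => (mem_leftPart.1 ht).1.1) _ fun l hl t ht => ?_
  rw [mem_leftPart]
  have hR : t ∈ R := (isLozengeTiling_iff.1 hT).1 l hl t ht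
  have hle := l.strip_leftHalf_le
  constructor
  · intro h
    refine ⟨⟨hR, ?_⟩, ?_⟩
    · rcases Lozenge.mem_triangles.1 ht with rfl | rfl <;> omega
    · rintro i hi rfl
      have := hT.eq_of_mem hl ((hS i).1 hi) ht (by simp [Lozenge.triangles, Lozenge.leftHalf])
      subst this
      simp [Lozenge.rightHalf, UnitTriangle.strip] at h
  · rintro ⟨⟨-, h⟩, hn⟩
    rcases Lozenge.mem_triangles.1 ht with rfl | rfl
    · by_contra hcon
      obtain ⟨i, rfl⟩ := Lozenge.eq_horizontal_of_strip h (not_le.1 hcon)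
      exact hn i ((hS i).2 hl) rfl
    · exact h

theorem IsLozengeTiling.filter_rightPart {T : Finset Lozenge} (hT : IsLozengeTiling R T)
    (hS : ∀ i, i ∈ S ↔ .horizontal c i ∈ T) :
    IsLozengeTiling (rightPart R c S) (T.filter fun l => c < l.leftHalf.strip) := by
  refine hT.filter (fun t ht => (mem_rightPart.1 ht).1.1) _ fun l hl t ht => ?_
  rw [mem_rightPart]
  have hR : t ∈ R := (isLozengeTiling_iff.1 hT).1 l hl t ht
  have hle := l.strip_leftHalf_le
  constructor
  · intro h
    refine ⟨⟨hR, ?_⟩, ?_⟩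
    · rcases Lozenge.mem_triangles.1 ht with rfl | rfl <;> omega
    · rintro i hi rfl
      have := hT.eq_of_mem hl ((hS i).1 hi) ht (by simp [Lozenge.triangles, Lozenge.rightHalf])
      subst this
      simp [Lozenge.leftHalf, UnitTriangle.strip] at h
  · rintro ⟨⟨-, h⟩, hn⟩
    rcases Lozenge.mem_triangles.1 ht with rfl | rfl
    · exact h
    · by_contra hcon
      obtain ⟨i, rfl⟩ := Lozenge.eq_horizontal_of_strip (not_lt.1 hcon) h
      exact hn i ((hS i).2 hl) rfl

theorem filter_union_filter_union_image_horizontal {T : Finset Lozenge}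
    (hS : ∀ i, i ∈ S ↔ .horizontal c i ∈ T) :
    (T.filter fun l => l.rightHalf.strip ≤ c) ∪ (T.filter fun l => c < l.leftHalf.strip) ∪
      S.image (.horizontal c) = T := by
  ext l
  simp only [Finset.mem_union, Finset.mem_filter, Finset.mem_image]
  constructor
  · rintro ((h | h) | ⟨i, hi, rfl⟩)
    · exact h.1
    · exact h.1
    · exact (hS i).1 hi
  · intro hl
    by_contra! hcon
    obtain ⟨i, rfl⟩ := Lozenge.eq_horizontal_of_strip (hcon.1.2 hl) (hcon.1.1 hl)
    exact hcon.2 i ((hS i).2 hl) rfl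

theorem strip_le_of_tiling_leftPart {T : Finset Lozenge} (hT : IsLozengeTiling (leftPart R c S) T)
    {l : Lozenge} (hl : l ∈ T) : l.rightHalf.strip ≤ c :=
  (mem_leftPart.1 ((isLozengeTiling_iff.1 hT).1 l hl _ (by simp [Lozenge.triangles]))).1.2

theorem lt_strip_of_tiling_rightPart {T : Finset Lozenge}
    (hT : IsLozengeTiling (rightPart R c S) T) {l : Lozenge} (hl : l ∈ T) :
    c < l.leftHalf.strip :=
  (mem_rightPart.1 ((isLozengeTiling_iff.1 hT).1 l hl _ (by simp [Lozenge.triangles]))).1.2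

/-- The transfer principle: the generating function of `R` is a sum over the possible sets of
heights of horizontal lozenges on the line `c`. -/
theorem tilingGF_eq_sum_powerset {K : Type*} [Field K] (q X Y : K) (R : Finset UnitTriangle) (c : ℤ)
    (I : Finset ℤ) (hI : ∀ i, i ∈ I ↔ .left c i ∈ R ∧ .right c i ∈ R) :
    tilingGF q X Y R = ∑ S ∈ I.powerset, (∏ i ∈ S, qCosh q X Y i) *
      (tilingGF q X Y (leftPart R c S) * tilingGF q X Y (rightPart R c S)) := by
  classical
  unfold tilingGF
  rw [← Finset.sum_fiberwise_of_maps_to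
    (g := fun T : Finset Lozenge => I.filter fun i => .horizontal c i ∈ T) (t := I.powerset)
    (fun T _ => Finset.mem_powerset.2 (Finset.filter_subset _ _))]
  refine Finset.sum_congr rfl fun S hSI => ?_
  have hS : ∀ i ∈ S, .left c i ∈ R ∧ .right c i ∈ R := fun i hi =>
    (hI i).1 (Finset.mem_powerset.1 hSI hi)
  rw [Finset.sum_mul_sum, ← Finset.sum_product', Finset.mul_sum]
  have key {T : Finset Lozenge}
      (hT : T ∈ (lozengeTilings R).filter fun T => (I.filter fun i => .horizontal c i ∈ T) = S) :
      IsLozengeTiling R T ∧ ∀ i, i ∈ S ↔ .horizontal c i ∈ T := by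
    rw [Finset.mem_filter, mem_lozengeTilings] at hT
    refine ⟨hT.1, fun i => ?_⟩
    rw [← hT.2, Finset.mem_filter, and_iff_right_iff_imp]
    exact fun h => (hI i).2
      ⟨(isLozengeTiling_iff.1 hT.1).1 _ h _ (by simp [Lozenge.triangles, Lozenge.leftHalf]),
        (isLozengeTiling_iff.1 hT.1).1 _ h _ (by simp [Lozenge.triangles, Lozenge.rightHalf])⟩
  have hhor (i : ℤ) : (Lozenge.horizontal c i).leftHalf.strip = c ∧
      (Lozenge.horizontal c i).rightHalf.strip = c + 1 := ⟨rfl, rfl⟩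
  refine Finset.sum_bij' (fun T _ => (T.filter fun l => l.rightHalf.strip ≤ c,
      T.filter fun l => c < l.leftHalf.strip))
    (fun P _ => P.1 ∪ P.2 ∪ S.image (.horizontal c)) ?_ ?_ ?_ ?_ ?_
  · intro T hT
    obtain ⟨hT, hST⟩ := key hT
    simp only [Finset.mem_product, mem_lozengeTilings]
    exact ⟨hT.filter_leftPart hST, hT.filter_rightPart hST⟩
  · rintro ⟨T, U⟩ h
    simp only [Finset.mem_product, mem_lozengeTilings] at h
    simp only [Finset.mem_filter, mem_lozengeTilings]
    refine ⟨h.1.glue hS h.2, ?_⟩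
    ext i
    simp only [Finset.mem_filter, Finset.mem_union, Finset.mem_image, Lozenge.horizontal.injEq,
      true_and, exists_eq_right]
    refine ⟨?_, fun hi => ⟨Finset.mem_powerset.1 hSI hi, .inr hi⟩⟩
    rintro ⟨-, (hi | hi) | hi⟩
    · have := strip_le_of_tiling_leftPart h.1 hi
      have := hhor i
      omega
    · have := lt_strip_of_tiling_rightPart h.2 hi
      have := hhor i
      omega
    · exact hi
  · intro T hT
    exact filter_union_filter_union_image_horizontal (key hT).2
  · rintro ⟨T, U⟩ h
    simp only [Finset.mem_product, mem_lozengeTilings] at h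
    have h1 := fun l => strip_le_of_tiling_leftPart h.1 (l := l)
    have h2 := fun l => lt_strip_of_tiling_rightPart h.2 (l := l)
    simp only [Prod.mk.injEq]
    constructor
    · ext l
      simp only [Finset.mem_filter, Finset.mem_union, Finset.mem_image]
      refine ⟨?_, fun hl => ⟨.inl (.inl hl), h1 l hl⟩⟩
      rintro ⟨(hl | hl) | ⟨i, -, rfl⟩, hs⟩
      · exact hl
      · have := h2 l hl
        have := l.strip_leftHalf_le
        omega
      · have := hhor i
        omega
    · ext l
      simp only [Finset.mem_filter, Finset.mem_union, Finset.mem_image]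
      refine ⟨?_, fun hl => ⟨.inl (.inr hl), h2 l hl⟩⟩
      rintro ⟨(hl | hl) | ⟨i, -, rfl⟩, hs⟩
      · have := h1 l hl
        have := l.strip_leftHalf_le
        omega
      · exact hl
      · have := hhor i
        omega
  · intro T hT
    obtain ⟨hT, hST⟩ := key hT
    conv_lhs => rw [← filter_union_filter_union_image_horizontal hST]
    rw [Finset.prod_union, Finset.prod_union, Finset.prod_image (fun _ _ _ _ h => by simpa using h)]
    · exact mul_comm _ _
    · rw [Finset.disjoint_left]
      intro l hl hl'
      rw [Finset.mem_filter] at hl hl'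
      have := l.strip_leftHalf_le
      omega
    · rw [Finset.disjoint_left]
      intro l hl hl'
      obtain ⟨i, -, rfl⟩ := Finset.mem_image.1 hl'
      have := hhor i
      simp only [Finset.mem_union, Finset.mem_filter] at hl
      omega

end Cut

/-! ### Interlacing sets -/

/-- The number of elements of `S` that are at most `m`. -/
def rankLE (S : Finset ℕ) (m : ℕ) : ℕ := Nat.count (· ∈ S) (m + 1)

/-- `V` interlaces with `W`: if `w₀ < w₁ < ⋯ < wₙ` are the elements of `W`, then `V` consists of
exactly one element of each interval `[wᵢ, wᵢ₊₁)`. This is encoded by the rank functions, which is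
the form in which tilings of a strip see it; `sum_interlaces_eq_sum_piFinset` gives the form in
terms of the intervals. -/
def Interlaces (V W : Finset ℕ) : Prop :=
  (∀ m, rankLE V m ≤ rankLE W m ∧ rankLE W m ≤ rankLE V m + 1) ∧
    (∀ m ∈ V, rankLE W m = rankLE V m) ∧ W.card = V.card + 1

section Rank

theorem rankLE_succ (S : Finset ℕ) (m : ℕ) :
    rankLE S (m + 1) = rankLE S m + if m + 1 ∈ S then 1 else 0 :=
  Nat.count_succ _ _

theorem rankLE_eq_card_filter (S : Finset ℕ) (m : ℕ) :
    rankLE S m = (S.filter (· ≤ m)).card := by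
  rw [rankLE, Nat.count_eq_card_filter_range]
  congr 1
  ext a
  rw [Finset.mem_filter, Finset.mem_filter, Finset.mem_range, Nat.lt_succ_iff, and_comm]

theorem rankLE_le_card (S : Finset ℕ) (m : ℕ) : rankLE S m ≤ S.card := by
  rw [rankLE_eq_card_filter]
  exact Finset.card_filter_le _ _

theorem rankLE_eq_card {S : Finset ℕ} {n m : ℕ} (hS : S ⊆ Finset.Icc 1 n) (hm : n ≤ m) :
    rankLE S m = S.card := by
  rw [rankLE_eq_card_filter, Finset.filter_true_of_mem]
  intro a ha
  have := Finset.mem_Icc.1 (hS ha)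
  omega

theorem rankLE_zero {S : Finset ℕ} {n : ℕ} (hS : S ⊆ Finset.Icc 1 n) : rankLE S 0 = 0 := by
  rw [rankLE_eq_card_filter, Finset.card_eq_zero, Finset.filter_eq_empty_iff]
  intro a ha
  have := Finset.mem_Icc.1 (hS ha)
  omega

theorem rankLE_image_le_iff {n : ℕ} {w : Fin n → ℕ} (hw : StrictMono w) (i : Fin n) (m : ℕ) :
    rankLE (Finset.univ.image w) m ≤ i ↔ m < w i := by
  have hr : rankLE (Finset.univ.image w) m = (Finset.univ.filter fun j => w j ≤ m).card := by
    rw [rankLE_eq_card_filter, Finset.filter_image,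
      Finset.card_image_of_injective _ hw.injective]
  rw [hr]
  constructor
  · intro h
    by_contra! hcon
    have hsub : Finset.Iic i ⊆ Finset.univ.filter fun j => w j ≤ m := fun j hj =>
      Finset.mem_filter.2 ⟨Finset.mem_univ _, (hw.monotone (Finset.mem_Iic.1 hj)).trans hcon⟩
    have := Finset.card_le_card hsub
    rw [Fin.card_Iic] at this
    omega
  · intro h
    have hsub : (Finset.univ.filter fun j => w j ≤ m) ⊆ Finset.Iio i := fun j hj => by
      rw [Finset.mem_Iio, ← hw.lt_iff_lt]
      exact (Finset.mem_filter.1 hj).2.trans_lt h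
    have := Finset.card_le_card hsub
    rwa [Fin.card_Iio] at this

end Rank

theorem interlaces_image_iff {n : ℕ} {w : Fin (n + 1) → ℕ} (hw : StrictMono w) {u : Fin n → ℕ}
    (hu : StrictMono u) :
    Interlaces (Finset.univ.image u) (Finset.univ.image w) ↔
      ∀ i, w i.castSucc ≤ u i ∧ u i < w i.succ := by
  have hcu : (Finset.univ.image u).card = n := by
    rw [Finset.card_image_of_injective _ hu.injective, Finset.card_fin]
  have hcw : (Finset.univ.image w).card = n + 1 := by
    rw [Finset.card_image_of_injective _ hw.injective, Finset.card_fin]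
  have ru := rankLE_image_le_iff hu
  have rw' := rankLE_image_le_iff hw
  have lu := rankLE_le_card (Finset.univ.image u)
  have lw := rankLE_le_card (Finset.univ.image w)
  rw [hcu] at lu
  rw [hcw] at lw
  constructor
  · rintro ⟨-, h, -⟩ i
    have hi := h (u i) (Finset.mem_image_of_mem _ (Finset.mem_univ i))
    have h1 := ru i (u i)
    have h2 := rw' i.castSucc (u i)
    have h3 := rw' i.succ (u i)
    rw [Fin.val_castSucc] at h2
    rw [Fin.val_succ] at h3
    refine ⟨by omega, h3.1 ?_⟩
    rw [hi]
    by_cases hlt : (i : ℕ) + 1 < n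
    · exact (ru ⟨i + 1, hlt⟩ (u i)).2 (hu (Fin.mk_lt_mk.2 (Nat.lt_succ_self _)))
    · have := lu (u i)
      omega
  · intro h
    refine ⟨fun m => ⟨?_, ?_⟩, ?_, by rw [hcu, hcw]⟩
    · by_contra! hcon
      have hlt := hcon.trans_le (lu m)
      have h1 := ru ⟨_, hlt⟩ m
      have h2 := rw' (Fin.castSucc ⟨_, hlt⟩) m
      have h3 := h ⟨_, hlt⟩
      simp only [Fin.castSucc_mk] at h1 h2 h3
      omega
    · by_contra! hcon
      have hlt : rankLE (Finset.univ.image u) m < n := by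
        have := lw m
        omega
      have h1 := ru ⟨_, hlt⟩ m
      have h2 := rw' (Fin.succ ⟨_, hlt⟩) m
      have h3 := h ⟨_, hlt⟩
      simp only [Fin.succ_mk] at h1 h2 h3
      omega
    · intro m hm
      obtain ⟨i, -, rfl⟩ := Finset.mem_image.1 hm
      have h1 := ru i (u i)
      have h2 := rw' i.castSucc (u i)
      have h3 := rw' i.succ (u i)
      have h4 := h i
      rw [Fin.val_castSucc] at h2
      rw [Fin.val_succ] at h3
      have h5 : rankLE (Finset.univ.image u) (u i) ≤ i + 1 := by
        by_cases hlt : (i : ℕ) + 1 < n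
        · exact (ru ⟨i + 1, hlt⟩ (u i)).2 (hu (Fin.mk_lt_mk.2 (Nat.lt_succ_self _)))
        · have := lu (u i)
          omega
      omega

theorem strictMono_of_mem_piFinset_Ico {n : ℕ} {w : Fin (n + 1) → ℕ} (hw : StrictMono w)
    {u : Fin n → ℕ} (hu : ∀ i, w i.castSucc ≤ u i ∧ u i < w i.succ) : StrictMono u := by
  intro i j hij
  calc u i < w i.succ := (hu i).2
    _ ≤ w j.castSucc := hw.monotone (by simpa [Fin.le_def] using hij)
    _ ≤ u j := (hu j).1

open Classical in
theorem sum_interlaces_eq_sum_piFinset {M : Type*} [AddCommMonoid M] {n N : ℕ}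
    {w : Fin (n + 1) → ℕ} (hw : StrictMono w)
    (hwN : Finset.univ.image w ⊆ Finset.Icc 1 (N + 1)) (g : Finset ℕ → M) :
    ∑ V ∈ (Finset.Icc 1 N).powerset.filter (fun V => Interlaces V (Finset.univ.image w)), g V =
      ∑ u ∈ Fintype.piFinset fun i : Fin n => Finset.Ico (w i.castSucc) (w i.succ),
        g (Finset.univ.image u) := by
  symm
  refine Finset.sum_bij (fun u _ => Finset.univ.image u) ?_ ?_ ?_ (fun _ _ => rfl)
  · intro u hu
    simp only [Fintype.mem_piFinset, Finset.mem_Ico] at hu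
    rw [Finset.mem_filter, Finset.mem_powerset]
    refine ⟨?_, (interlaces_image_iff hw (strictMono_of_mem_piFinset_Ico hw hu)).2 hu⟩
    intro m hm
    obtain ⟨i, -, rfl⟩ := Finset.mem_image.1 hm
    have h1 := Finset.mem_Icc.1 (hwN (Finset.mem_image_of_mem w (Finset.mem_univ i.castSucc)))
    have h2 := Finset.mem_Icc.1 (hwN (Finset.mem_image_of_mem w (Finset.mem_univ i.succ)))
    have h3 := hu i
    rw [Finset.mem_Icc]
    omega
  · intro u hu u' hu' h
    simp only [Fintype.mem_piFinset, Finset.mem_Ico] at hu hu'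
    refine (StrictMono.range_inj (strictMono_of_mem_piFinset_Ico hw hu)
      (strictMono_of_mem_piFinset_Ico hw hu')).1 ?_
    have := congrArg (fun s : Finset ℕ => (s : Set ℕ)) h
    simpa using this
  · intro V hV
    rw [Finset.mem_filter, Finset.mem_powerset] at hV
    have hcard : V.card = n := by
      have := hV.2.2.2
      rw [Finset.card_image_of_injective _ hw.injective, Finset.card_fin] at this
      omega
    have himg : Finset.univ.image (V.orderEmbOfFin hcard) = V :=
      Finset.image_orderEmbOfFin_univ V hcard
    refine ⟨V.orderEmbOfFin hcard, ?_, himg⟩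
    simp only [Fintype.mem_piFinset, Finset.mem_Ico]
    rw [← interlaces_image_iff hw (V.orderEmbOfFin hcard).strictMono, himg]
    exact hV.2

/-! ### Tilings of a strip of width one -/

/-- The rank functions of `V` and `W` follow a chain of unit triangles in which right-pointing
triangles `m ∉ V` are matched either upwards (`r m`) to the left-pointing triangle `m + 1` or
downwards (`p m`) to the left-pointing triangle `m`. -/
theorem rankLE_eq_add_of_matching {V W : Finset ℕ} {n : ℕ} (hV : V ⊆ Finset.Icc 1 n)
    (hW : W ⊆ Finset.Icc 1 (n + 1)) {r p : ℕ → Prop} [DecidablePred r]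
    (hr : ∀ m, r m → (1 ≤ m ∧ m ≤ n) ∧ m ∉ V ∧ m + 1 ∉ W)
    (hp : ∀ m, p m → (1 ≤ m ∧ m ≤ n) ∧ m ∉ V ∧ m ∉ W)
    (hR : ∀ m, 1 ≤ m → m ≤ n → m ∉ V → (r m ↔ ¬ p m))
    (hL : ∀ m, m ≤ n → m + 1 ∉ W → (r m ↔ ¬ p (m + 1))) {m : ℕ} (hm : m ≤ n) :
    rankLE W m = rankLE V m + if r m then 1 else 0 := by
  induction m with
  | zero =>
    rw [rankLE_zero hV, rankLE_zero hW, if_neg]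
    intro h
    have := hr 0 h
    omega
  | succ m ih =>
    have ih := ih (by omega)
    rw [rankLE_succ, rankLE_succ, ih]
    have h1 (h : r m) := (hr m h).2.2
    have h2 (h : r (m + 1)) := (hr _ h).2.1
    have h3 (h : p (m + 1)) := (hp _ h).2
    have h4 := hR (m + 1) (by omega) hm
    have h5 := hL m (by omega)
    clear hr hp hR hL ih
    split_ifs <;> first | omega | (exfalso; tauto)

theorem interlaces_of_matching {V W : Finset ℕ} {n : ℕ} (hV : V ⊆ Finset.Icc 1 n)
    (hW : W ⊆ Finset.Icc 1 (n + 1)) {r p : ℕ → Prop}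
    (hr : ∀ m, r m → (1 ≤ m ∧ m ≤ n) ∧ m ∉ V ∧ m + 1 ∉ W)
    (hp : ∀ m, p m → (1 ≤ m ∧ m ≤ n) ∧ m ∉ V ∧ m ∉ W)
    (hR : ∀ m, 1 ≤ m → m ≤ n → m ∉ V → (r m ↔ ¬ p m))
    (hL : ∀ m, m ≤ n → m + 1 ∉ W → (r m ↔ ¬ p (m + 1))) : Interlaces V W := by
  classical
  have key {m : ℕ} (hm : m ≤ n) := rankLE_eq_add_of_matching hV hW hr hp hR hL hm
  have hcard : W.card = V.card + 1 := by
    have h := key le_rfl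
    rw [rankLE_eq_card hV le_rfl] at h
    rw [← rankLE_eq_card hW le_rfl, rankLE_succ, h]
    have h1 (h : r n) := (hr n h).2.2
    have h2 (h : p (n + 1)) : False := by
      have := hp _ h
      omega
    have h3 := hL n le_rfl
    clear hr hp hR hL key
    split_ifs <;> first | omega | (exfalso; tauto)
  refine ⟨fun m => ?_, fun m hm => ?_, hcard⟩
  · rcases le_or_gt m n with h | h
    · rw [key h]
      split_ifs <;> omega
    · rw [rankLE_eq_card hV h.le, rankLE_eq_card hW h, hcard]
      omega
  · rw [key (Finset.mem_Icc.1 (hV hm)).2, if_neg (fun h => (hr m h).2.1 hm), add_zero]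

/-- The strip between the lines `j` and `j + 1`, with `n` right-pointing triangles on the line `j`
and `n + 1` left-pointing triangles on the line `j + 1`, numbered from the bottom to the top, of
which those numbered by `V` and by `W`, respectively, are deleted. The `m`-th right-pointing
triangle is at height `a + 2 * m`. -/
def stripRegion (j a : ℤ) (n : ℕ) (V W : Finset ℕ) : Finset UnitTriangle :=
  (Finset.Icc 1 n \ V).image (fun m : ℕ => .right j (a + 2 * m)) ∪
    (Finset.Icc 1 (n + 1) \ W).image (fun m : ℕ => .left (j + 1) (a + 2 * m - 1))

/-- The only possible tiling of `stripRegion j a n V W`. -/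
def stripTiling (j a : ℤ) (n : ℕ) (V W : Finset ℕ) : Finset Lozenge :=
  ((Finset.Icc 1 n).filter fun m => rankLE V m < rankLE W m).image
      (fun m : ℕ => .positive j (a + 2 * m + 1)) ∪
    ((Finset.Icc 1 n).filter fun m => m ∉ V ∧ rankLE W m ≤ rankLE V m).image
      (fun m : ℕ => .negative j (a + 2 * m - 1))

section Strip

variable {j a : ℤ} {n : ℕ} {V W : Finset ℕ}

theorem right_mem_stripRegion {m : ℕ} :
    .right j (a + 2 * m) ∈ stripRegion j a n V W ↔ (1 ≤ m ∧ m ≤ n) ∧ m ∉ V := by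
  simp [stripRegion]

theorem left_mem_stripRegion {m : ℕ} :
    .left (j + 1) (a + 2 * m - 1) ∈ stripRegion j a n V W ↔ (1 ≤ m ∧ m ≤ n + 1) ∧ m ∉ W := by
  simp [stripRegion]

theorem mem_stripRegion {t : UnitTriangle} :
    t ∈ stripRegion j a n V W ↔
      (∃ m : ℕ, ((1 ≤ m ∧ m ≤ n) ∧ m ∉ V) ∧ t = .right j (a + 2 * m)) ∨
      ∃ m : ℕ, ((1 ≤ m ∧ m ≤ n + 1) ∧ m ∉ W) ∧ t = .left (j + 1) (a + 2 * m - 1) := by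
  simp [stripRegion, eq_comm]

theorem positive_mem_stripTiling {m : ℕ} :
    .positive j (a + 2 * m + 1) ∈ stripTiling j a n V W ↔
      (1 ≤ m ∧ m ≤ n) ∧ rankLE V m < rankLE W m := by
  simp [stripTiling]

theorem negative_mem_stripTiling {m : ℕ} :
    .negative j (a + 2 * m - 1) ∈ stripTiling j a n V W ↔
      (1 ≤ m ∧ m ≤ n) ∧ m ∉ V ∧ rankLE W m ≤ rankLE V m := by
  simp [stripTiling]

theorem mem_stripTiling {l : Lozenge} :
    l ∈ stripTiling j a n V W ↔
      (∃ m : ℕ, ((1 ≤ m ∧ m ≤ n) ∧ rankLE V m < rankLE W m) ∧ l = .positive j (a + 2 * m + 1)) ∨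
      ∃ m : ℕ, ((1 ≤ m ∧ m ≤ n) ∧ m ∉ V ∧ rankLE W m ≤ rankLE V m) ∧
        l = .negative j (a + 2 * m - 1) := by
  simp [stripTiling, eq_comm]

theorem eq_positive_or_negative_of_subset_stripRegion {l : Lozenge}
    (hl : ∀ t ∈ l.triangles, t ∈ stripRegion j a n V W) :
    (∃ m : ℕ, ((1 ≤ m ∧ m ≤ n) ∧ m ∉ V ∧ m + 1 ∉ W) ∧ l = .positive j (a + 2 * m + 1)) ∨
      ∃ m : ℕ, ((1 ≤ m ∧ m ≤ n) ∧ m ∉ V ∧ m ∉ W) ∧ l = .negative j (a + 2 * m - 1) := by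
  have h1 := hl _ (Lozenge.mem_triangles.2 (.inl rfl))
  have h2 := hl _ (Lozenge.mem_triangles.2 (.inr rfl))
  rw [mem_stripRegion] at h1 h2
  cases l with
  | horizontal c i =>
    simp only [Lozenge.leftHalf, Lozenge.rightHalf, reduceCtorEq, and_false, exists_false,
      false_or, or_false, UnitTriangle.left.injEq, UnitTriangle.right.injEq] at h1 h2
    obtain ⟨-, -, h, -⟩ := h1
    obtain ⟨-, -, h', -⟩ := h2
    omega
  | positive c i =>
    simp only [Lozenge.leftHalf, Lozenge.rightHalf, reduceCtorEq, and_false, exists_false,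
      false_or, or_false, UnitTriangle.left.injEq, UnitTriangle.right.injEq] at h1 h2
    obtain ⟨m', hm', h, h'⟩ := h1
    obtain ⟨m, hm, rfl, h''⟩ := h2
    obtain rfl : m' = m + 1 := by omega
    exact .inl ⟨m, ⟨hm.1, hm.2, hm'.2⟩, by congr 1; omega⟩
  | negative c i =>
    simp only [Lozenge.leftHalf, Lozenge.rightHalf, reduceCtorEq, and_false, exists_false,
      false_or, or_false, UnitTriangle.left.injEq, UnitTriangle.right.injEq] at h1 h2
    obtain ⟨m', hm', h, h'⟩ := h1
    obtain ⟨m, hm, rfl, h''⟩ := h2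
    obtain rfl : m' = m := by omega
    exact .inr ⟨m', ⟨hm.1, hm.2, hm'.2⟩, by congr 1⟩

theorem right_mem_triangles_iff {l : Lozenge} (hl : ∀ t ∈ l.triangles, t ∈ stripRegion j a n V W)
    (m : ℕ) : .right j (a + 2 * m) ∈ l.triangles ↔
      l = .positive j (a + 2 * m + 1) ∨ l = .negative j (a + 2 * m - 1) := by
  rcases eq_positive_or_negative_of_subset_stripRegion hl with ⟨m', -, rfl⟩ | ⟨m', -, rfl⟩
  all_goals
    simp only [Lozenge.mem_triangles, Lozenge.leftHalf, Lozenge.rightHalf,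
      UnitTriangle.right.injEq, Lozenge.positive.injEq, Lozenge.negative.injEq, reduceCtorEq,
      false_or, or_false, true_and]
    omega

theorem left_mem_triangles_iff {l : Lozenge} (hl : ∀ t ∈ l.triangles, t ∈ stripRegion j a n V W)
    (m : ℕ) : .left (j + 1) (a + 2 * (m + 1 : ℕ) - 1) ∈ l.triangles ↔
      l = .positive j (a + 2 * m + 1) ∨ l = .negative j (a + 2 * (m + 1 : ℕ) - 1) := by
  rcases eq_positive_or_negative_of_subset_stripRegion hl with ⟨m', -, rfl⟩ | ⟨m', -, rfl⟩
  all_goals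
    simp only [Lozenge.mem_triangles, Lozenge.leftHalf, Lozenge.rightHalf,
      UnitTriangle.left.injEq, Lozenge.positive.injEq, Lozenge.negative.injEq, reduceCtorEq,
      false_or, or_false, true_and]
    omega

theorem existsUnique_mem_iff_xor {α : Type*} {T : Finset α} {P : α → Prop} {x y : α} (hxy : x ≠ y)
    (h : ∀ l ∈ T, P l ↔ l = x ∨ l = y) : (∃! l, l ∈ T ∧ P l) ↔ (x ∈ T ↔ y ∉ T) := by
  have h' : (∃! l, l ∈ T ∧ P l) ↔ ∃! l, l ∈ T ∧ (l = x ∨ l = y) :=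
    existsUnique_congr fun l => and_congr_right (h l)
  rw [h']
  constructor
  · rintro ⟨l, hl, hu⟩
    constructor
    · intro hx hy
      exact hxy ((hu x ⟨hx, .inl rfl⟩).trans (hu y ⟨hy, .inr rfl⟩).symm)
    · intro hy
      by_contra hx
      rcases hl with ⟨hl, rfl | rfl⟩
      · exact hx hl
      · exact hy hl
  · intro hT
    by_cases hx : x ∈ T
    · refine ⟨x, ⟨hx, .inl rfl⟩, ?_⟩
      rintro l ⟨hl, rfl | rfl⟩
      · rfl
      · exact absurd hl (hT.1 hx)
    · have hy : y ∈ T := by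
        by_contra hy
        exact hx (hT.2 hy)
      refine ⟨y, ⟨hy, .inr rfl⟩, ?_⟩
      rintro l ⟨hl, rfl | rfl⟩
      · exact absurd hl hx
      · rfl

/-- In the strip, being a tiling means that each right-pointing and each left-pointing triangle is
covered by exactly one of its two neighbouring lozenges. -/
theorem isLozengeTiling_stripRegion_iff {T : Finset Lozenge} :
    IsLozengeTiling (stripRegion j a n V W) T ↔
      (∀ l ∈ T, ∀ t ∈ l.triangles, t ∈ stripRegion j a n V W) ∧
      (∀ m : ℕ, 1 ≤ m → m ≤ n → m ∉ V →
        (.positive j (a + 2 * m + 1) ∈ T ↔ .negative j (a + 2 * m - 1) ∉ T)) ∧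
      ∀ m : ℕ, m ≤ n → m + 1 ∉ W →
        (.positive j (a + 2 * m + 1) ∈ T ↔ .negative j (a + 2 * (m + 1 : ℕ) - 1) ∉ T) := by
  rw [isLozengeTiling_iff]
  refine and_congr_right fun hT => ?_
  have e1 (m : ℕ) := existsUnique_mem_iff_xor (T := T) (x := .positive j (a + 2 * m + 1))
    (y := .negative j (a + 2 * m - 1)) (by simp) fun l hl => right_mem_triangles_iff (hT l hl) m
  have e2 (m : ℕ) := existsUnique_mem_iff_xor (T := T) (x := .positive j (a + 2 * m + 1))
    (y := .negative j (a + 2 * (m + 1 : ℕ) - 1)) (by simp)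
    fun l hl => left_mem_triangles_iff (hT l hl) m
  constructor
  · intro h
    exact ⟨fun m h1 h2 h3 => (e1 m).1 (h _ (right_mem_stripRegion.2 ⟨⟨h1, h2⟩, h3⟩)),
      fun m h1 h2 => (e2 m).1 (h _ (left_mem_stripRegion.2 ⟨⟨by omega, by omega⟩, h2⟩))⟩
  · rintro ⟨h1, h2⟩ t ht
    rcases mem_stripRegion.1 ht with ⟨m, hm, rfl⟩ | ⟨m, hm, rfl⟩
    · exact (e1 m).2 (h1 m hm.1.1 hm.1.2 hm.2)
    · obtain ⟨m, rfl⟩ : ∃ m', m = m' + 1 := ⟨m - 1, by omega⟩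
      exact (e2 m).2 (h2 m (by omega) hm.2)

theorem Interlaces.isLozengeTiling_stripTiling (h : Interlaces V W) (hV : V ⊆ Finset.Icc 1 n)
    (hW : W ⊆ Finset.Icc 1 (n + 1)) :
    IsLozengeTiling (stripRegion j a n V W) (stripTiling j a n V W) := by
  obtain ⟨h1, h2, h3⟩ := h
  have hs (m : ℕ) := rankLE_succ V m
  have hs' (m : ℕ) := rankLE_succ W m
  rw [isLozengeTiling_stripRegion_iff]
  refine ⟨fun l hl t ht => ?_, fun m hm1 hm2 hm3 => ?_, fun m hm1 hm2 => ?_⟩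
  · rw [mem_stripRegion]
    rcases mem_stripTiling.1 hl with ⟨m, ⟨hm, hlt⟩, rfl⟩ | ⟨m, ⟨hm, hmV, hle⟩, rfl⟩
    · have hmW : m + 1 ∉ W := by
        intro hw
        have a1 := hs m
        have a2 := hs' m
        have a3 := h1 (m + 1)
        rw [if_pos hw] at a2
        by_cases hv : m + 1 ∈ V
        · have := h2 _ hv
          rw [if_pos hv] at a1
          omega
        · rw [if_neg hv] at a1
          omega
      have hmV : m ∉ V := fun hv => by
        have := h2 m hv
        omega
      rcases Lozenge.mem_triangles.1 ht with rfl | rfl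
      · refine .inr ⟨m + 1, ⟨by omega, hmW⟩, ?_⟩
        rw [Lozenge.leftHalf, UnitTriangle.left.injEq]
        push_cast
        exact ⟨rfl, by ring⟩
      · exact .inl ⟨m, ⟨hm, hmV⟩, by simp only [Lozenge.rightHalf]; congr 1; ring⟩
    · have hmW : m ∉ W := by
        intro hw
        obtain ⟨m, rfl⟩ : ∃ m', m = m' + 1 := ⟨m - 1, by omega⟩
        have a1 := hs m
        have a2 := hs' m
        have a3 := h1 m
        rw [if_pos hw] at a2
        rw [if_neg hmV] at a1
        omega
      rcases Lozenge.mem_triangles.1 ht with rfl | rfl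
      · exact .inr ⟨m, ⟨by omega, hmW⟩, rfl⟩
      · exact .inl ⟨m, ⟨hm, hmV⟩, by simp only [Lozenge.rightHalf]; congr 1; ring⟩
  · rw [positive_mem_stripTiling, negative_mem_stripTiling]
    simp only [hm1, hm2, hm3, and_self, true_and, not_le, not_false_eq_true]
  · rw [positive_mem_stripTiling, negative_mem_stripTiling]
    have a1 := hs m
    have a2 := hs' m
    rw [if_neg hm2] at a2
    have a3 := h1 m
    have a4 := h1 (m + 1)
    have b1 : m = 0 → rankLE V m = rankLE W m := by
      rintro rfl
      rw [rankLE_zero hV, rankLE_zero hW]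
    have b2 : n ≤ m → rankLE W (m + 1) = rankLE V (m + 1) + 1 := fun hn => by
      rw [rankLE_eq_card hV (by omega), rankLE_eq_card hW (by omega), h3]
    by_cases hv : m + 1 ∈ V
    · have b3 := h2 _ hv
      have b4 := Finset.mem_Icc.1 (hV hv)
      rw [if_pos hv] at a1
      simp only [hv, not_true_eq_false, false_and, and_false, not_false_eq_true, iff_true]
      omega
    · rw [if_neg hv] at a1
      simp only [hv, not_false_eq_true, true_and]
      omega

theorem IsLozengeTiling.interlaces_of_stripRegion {T : Finset Lozenge}
    (hT : IsLozengeTiling (stripRegion j a n V W) T) (hV : V ⊆ Finset.Icc 1 n)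
    (hW : W ⊆ Finset.Icc 1 (n + 1)) : Interlaces V W ∧ T = stripTiling j a n V W := by
  rw [isLozengeTiling_stripRegion_iff] at hT
  obtain ⟨hsub, hR, hL⟩ := hT
  have hr (m : ℕ) (h : .positive j (a + 2 * m + 1) ∈ T) :
      (1 ≤ m ∧ m ≤ n) ∧ m ∉ V ∧ m + 1 ∉ W := by
    rcases eq_positive_or_negative_of_subset_stripRegion (hsub _ h) with
      ⟨m', hm', he⟩ | ⟨m', hm', he⟩
    · simp only [Lozenge.positive.injEq, true_and] at he
      obtain rfl : m' = m := by omega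
      exact hm'
    · simp at he
  have hp (m : ℕ) (h : .negative j (a + 2 * m - 1) ∈ T) :
      (1 ≤ m ∧ m ≤ n) ∧ m ∉ V ∧ m ∉ W := by
    rcases eq_positive_or_negative_of_subset_stripRegion (hsub _ h) with
      ⟨m', hm', he⟩ | ⟨m', hm', he⟩
    · simp at he
    · simp only [Lozenge.negative.injEq, true_and] at he
      obtain rfl : m' = m := by omega
      exact hm'
  refine ⟨interlaces_of_matching hV hW hr hp hR hL, ?_⟩
  have key {m : ℕ} (hm : m ≤ n) := rankLE_eq_add_of_matching hV hW hr hp hR hL hm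
  have hpos (m : ℕ) (hm : m ≤ n) :
      .positive j (a + 2 * m + 1) ∈ T ↔ rankLE V m < rankLE W m := by
    rw [key hm]
    split_ifs with h <;> simp [h]
  ext l
  rw [mem_stripTiling]
  constructor
  · intro hl
    rcases eq_positive_or_negative_of_subset_stripRegion (hsub _ hl) with
      ⟨m, hm, rfl⟩ | ⟨m, hm, rfl⟩
    · exact .inl ⟨m, ⟨hm.1, (hpos m hm.1.2).1 hl⟩, rfl⟩
    · refine .inr ⟨m, ⟨hm.1, hm.2.1, ?_⟩, rfl⟩
      rw [← not_lt, ← hpos m hm.1.2, hR m hm.1.1 hm.1.2 hm.2.1, not_not]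
      exact hl
  · rintro (⟨m, ⟨hm, hlt⟩, rfl⟩ | ⟨m, ⟨hm, hmV, hle⟩, rfl⟩)
    · exact (hpos m hm.2).2 hlt
    · rw [← not_lt, ← hpos m hm.2, hR m hm.1 hm.2 hmV, not_not] at hle
      exact hle

open Classical in
theorem tilingGF_stripRegion {K : Type*} [Field K] (q X Y : K) (hV : V ⊆ Finset.Icc 1 n)
    (hW : W ⊆ Finset.Icc 1 (n + 1)) :
    tilingGF q X Y (stripRegion j a n V W) = if Interlaces V W then 1 else 0 := by
  have htil : lozengeTilings (stripRegion j a n V W) =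
      if Interlaces V W then {stripTiling j a n V W} else ∅ := by
    ext T
    rw [mem_lozengeTilings]
    split_ifs with h
    · rw [Finset.mem_singleton]
      refine ⟨fun hT => (hT.interlaces_of_stripRegion hV hW).2, ?_⟩
      rintro rfl
      exact h.isLozengeTiling_stripTiling hV hW
    · simp only [Finset.notMem_empty, iff_false]
      exact fun hT => h (hT.interlaces_of_stripRegion hV hW).1
  rw [tilingGF, htil]
  split_ifs
  · rw [Finset.sum_singleton]
    refine Finset.prod_eq_one fun l hl => ?_
    rcases mem_stripTiling.1 hl with ⟨m, -, rfl⟩ | ⟨m, -, rfl⟩ <;> rfl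
  · rfl

end Strip

/-! ### Cutting the dented trapezoid along its last inner vertical line -/

theorem sideLabel_injective (x y : ℕ) : Function.Injective (sideLabel x y) := by
  intro m m' h
  simpa [sideLabel] using h

theorem segmentCentre_injective (k : ℤ) (N : ℕ) : Function.Injective (segmentCentre k N) := by
  intro m m' h
  unfold segmentCentre at h
  omega

theorem mem_dentedTrapezoidBar {x y : ℕ} {k : ℤ} {W : Finset ℕ} {t : UnitTriangle} :
    t ∈ dentedTrapezoidBar x y k W ↔
      (∃ j m : ℕ, (1 ≤ j ∧ j ≤ y) ∧ (1 ≤ m ∧ m ≤ x + j) ∧ (j = y → m ∉ W) ∧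
        t = .left j (segmentCentre k (x + j) m)) ∨
      ∃ j m : ℕ, j < y ∧ (1 ≤ m ∧ m ≤ x + j) ∧ t = .right j (segmentCentre k (x + j) m) := by
  simp only [dentedTrapezoidBar, dentedTrapezoid, trapezoid, Finset.mem_sdiff, Finset.mem_union,
    Finset.mem_biUnion, Finset.mem_image, Finset.mem_filter, Finset.mem_Icc, Finset.mem_range,
    (sideLabel_injective x y).eq_iff, exists_eq_right]
  constructor
  · rintro ⟨⟨j, hj, m, hm, rfl⟩ | ⟨j, hj, m, hm, rfl⟩, hn⟩
    · refine .inl ⟨j, m, hj, hm, ?_, rfl⟩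
      rintro rfl hW
      exact hn ⟨m, ⟨hm, hW⟩, rfl⟩
    · exact .inr ⟨j, m, hj, hm, rfl⟩
  · rintro (⟨j, m, hj, hm, hW, rfl⟩ | ⟨j, m, hj, hm, rfl⟩)
    · refine ⟨.inl ⟨j, hj, m, hm, rfl⟩, ?_⟩
      rintro ⟨m', ⟨hm', hW'⟩, h⟩
      rw [UnitTriangle.left.injEq, Nat.cast_inj] at h
      obtain ⟨rfl, h⟩ := h
      rw [segmentCentre_injective _ _ h] at hW'
      exact hW rfl hW'
    · refine ⟨.inr ⟨j, hj, m, hm, rfl⟩, ?_⟩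
      rintro ⟨m', -, h⟩
      simp at h

theorem leftPart_dentedTrapezoidBar (x y : ℕ) (k : ℤ) (V W : Finset ℕ) :
    leftPart (dentedTrapezoidBar x (y + 1) k W) y (V.image (segmentCentre k (x + y))) =
      dentedTrapezoidBar x y k V := by
  ext t
  rw [mem_leftPart, mem_dentedTrapezoidBar, mem_dentedTrapezoidBar]
  simp only [Finset.mem_image, forall_exists_index, and_imp, forall_apply_eq_imp_iff₂]
  constructor
  · rintro ⟨⟨⟨j, m, hj, hm, -, rfl⟩ | ⟨j, m, hj, hm, rfl⟩, hs⟩, hV⟩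
    · simp only [UnitTriangle.strip, Nat.cast_le] at hs
      refine .inl ⟨j, m, ⟨hj.1, hs⟩, hm, ?_, rfl⟩
      rintro rfl hmV
      exact hV m hmV rfl
    · simp only [UnitTriangle.strip] at hs
      exact .inr ⟨j, m, by omega, hm, rfl⟩
  · rintro (⟨j, m, hj, hm, hmV, rfl⟩ | ⟨j, m, hj, hm, rfl⟩)
    · refine ⟨⟨.inl ⟨j, m, by omega, hm, fun h => by omega, rfl⟩, ?_⟩, ?_⟩
      · simpa [UnitTriangle.strip] using hj.2
      · intro m' hm' h
        rw [UnitTriangle.left.injEq, Nat.cast_inj] at h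
        obtain ⟨rfl, h⟩ := h
        rw [segmentCentre_injective _ _ h] at hm'
        exact hmV rfl hm'
    · refine ⟨⟨.inr ⟨j, m, by omega, hm, rfl⟩, ?_⟩, fun m' hm' h => by simp at h⟩
      simp only [UnitTriangle.strip]
      omega

theorem rightPart_dentedTrapezoidBar (x y : ℕ) (k : ℤ) (V W : Finset ℕ) :
    rightPart (dentedTrapezoidBar x (y + 1) k W) y (V.image (segmentCentre k (x + y))) =
      stripRegion y (k - (x + y + 1)) (x + y) V W := by
  ext t
  rw [mem_rightPart, mem_dentedTrapezoidBar, mem_stripRegion]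
  simp only [Finset.mem_image, forall_exists_index, and_imp, forall_apply_eq_imp_iff₂]
  constructor
  · rintro ⟨⟨⟨j, m, hj, hm, hW, rfl⟩ | ⟨j, m, hj, hm, rfl⟩, hs⟩, hV⟩
    · simp only [UnitTriangle.strip, Nat.cast_lt] at hs
      obtain rfl : j = y + 1 := by omega
      refine .inr ⟨m, ⟨by omega, hW rfl⟩, ?_⟩
      rw [UnitTriangle.left.injEq, segmentCentre]
      push_cast
      exact ⟨rfl, by ring⟩
    · simp only [UnitTriangle.strip] at hs
      obtain rfl : j = y := by omega
      refine .inl ⟨m, ⟨hm, fun hmV => hV m hmV rfl⟩, ?_⟩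
      rw [UnitTriangle.right.injEq, segmentCentre]
      push_cast
      exact ⟨rfl, by ring⟩
  · rintro (⟨m, ⟨hm, hmV⟩, rfl⟩ | ⟨m, ⟨hm, hmW⟩, rfl⟩)
    · refine ⟨⟨.inr ⟨y, m, by omega, hm, ?_⟩, by simp [UnitTriangle.strip]⟩, ?_⟩
      · rw [UnitTriangle.right.injEq, segmentCentre]
        push_cast
        exact ⟨rfl, by ring⟩
      · intro m' hm' h
        rw [UnitTriangle.right.injEq, segmentCentre] at h
        obtain rfl : m' = m := by
          push_cast at h
          omega
        exact hmV hm'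
    · refine ⟨⟨.inl ⟨y + 1, m, by omega, by omega, fun _ => hmW, ?_⟩,
        by simp [UnitTriangle.strip]⟩, fun m' hm' h => by simp at h⟩
      rw [UnitTriangle.left.injEq, segmentCentre]
      push_cast
      exact ⟨rfl, by ring⟩

theorem dentedTrapezoidBar_one (x : ℕ) (k : ℤ) (W : Finset ℕ) :
    dentedTrapezoidBar x 1 k W = stripRegion (0 : ℕ) (k - (x + (0 : ℕ) + 1)) (x + 0) ∅ W := by
  rw [← rightPart_dentedTrapezoidBar]
  ext t
  rw [mem_rightPart]
  simp only [Finset.image_empty, Finset.notMem_empty, false_implies, implies_true, and_true,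
    zero_add, iff_self_and]
  intro ht
  rcases mem_dentedTrapezoidBar.1 ht with ⟨j, m, hj, -, -, rfl⟩ | ⟨j, m, hj, -, rfl⟩
  · exact Nat.cast_lt.2 hj.1
  · simp only [UnitTriangle.strip]
    omega

open Classical in
theorem tilingGF_dentedTrapezoidBar_one {K : Type*} [Field K] (q X Y : K) (x : ℕ) (k : ℤ)
    {W : Finset ℕ} (hW : W ⊆ Finset.Icc 1 (x + 1)) :
    tilingGF q X Y (dentedTrapezoidBar x 1 k W) = if W.card = 1 then 1 else 0 := by
  rw [dentedTrapezoidBar_one, tilingGF_stripRegion (n := x + 0) q X Y (Finset.empty_subset _) hW]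
  have h0 (m : ℕ) : rankLE ∅ m = 0 := Nat.le_zero.1 (rankLE_le_card ∅ m)
  have : Interlaces ∅ W ↔ W.card = 1 := by
    refine ⟨fun h => h.2.2, fun h => ⟨fun m => ?_, by simp, h⟩⟩
    have := rankLE_le_card W m
    rw [h0]
    omega
  simp only [this]

open Classical in
/-- The branching rule for the generating functions: the horizontal lozenges on the last inner
vertical line sit at a set interlacing with the dents, and what remains on the left is a smaller
dented trapezoid. -/
theorem tilingGF_dentedTrapezoidBar_succ {K : Type*} [Field K] (q X Y : K) (x : ℕ) {y : ℕ}
    (hy : 1 ≤ y) (k : ℤ) {W : Finset ℕ} (hW : W ⊆ Finset.Icc 1 (x + y + 1)) :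
    tilingGF q X Y (dentedTrapezoidBar x (y + 1) k W) =
      ∑ V ∈ (Finset.Icc 1 (x + y)).powerset.filter (fun V => Interlaces V W),
        (∏ m ∈ V, qCosh q X Y (segmentCentre k (x + y) m)) *
          tilingGF q X Y (dentedTrapezoidBar x y k V) := by
  have hinj := segmentCentre_injective k (x + y)
  rw [tilingGF_eq_sum_powerset q X Y _ y ((Finset.Icc 1 (x + y)).image (segmentCentre k (x + y))),
    Finset.powerset_image, Finset.sum_image (Finset.image_injective hinj).injOn,
    Finset.sum_filter]
  · refine Finset.sum_congr rfl fun V hV => ?_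
    rw [leftPart_dentedTrapezoidBar, rightPart_dentedTrapezoidBar,
      tilingGF_stripRegion q X Y (Finset.mem_powerset.1 hV) hW, Finset.prod_image hinj.injOn]
    split_ifs <;> simp
  · intro i
    rw [mem_dentedTrapezoidBar, mem_dentedTrapezoidBar]
    simp only [Finset.mem_image, Finset.mem_Icc, reduceCtorEq, and_false, exists_false, or_false,
      false_or, UnitTriangle.left.injEq, UnitTriangle.right.injEq, Nat.cast_inj]
    constructor
    · rintro ⟨m, hm, rfl⟩
      exact ⟨⟨y, m, by omega, hm, fun h => by omega, rfl, rfl⟩, ⟨y, m, by omega, hm, rfl, rfl⟩⟩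
    · rintro ⟨-, ⟨j, m, -, hm, rfl, rfl⟩⟩
      exact ⟨m, hm, rfl⟩

theorem tilingGF_dentedTrapezoidBar_eq_zero {K : Type*} [Field K] (q X Y : K) (x : ℕ) {y : ℕ}
    (hy : 1 ≤ y) (k : ℤ) {W : Finset ℕ} (hW : W ⊆ Finset.Icc 1 (x + y)) (hc : W.card ≠ y) :
    tilingGF q X Y (dentedTrapezoidBar x y k W) = 0 := by
  classical
  induction y, hy using Nat.le_induction generalizing W with
  | base => rw [tilingGF_dentedTrapezoidBar_one q X Y x k hW, if_neg hc]
  | succ y hy ih =>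
    rw [tilingGF_dentedTrapezoidBar_succ q X Y x hy k hW]
    refine Finset.sum_eq_zero fun V hV => ?_
    rw [Finset.mem_filter, Finset.mem_powerset] at hV
    rw [ih hV.1 (fun h => hc (by rw [hV.2.2.2, h])), mul_zero]

/-- For `q = X = Y = 1` all weights are `1`, and the generating function counts the tilings. Hence a
generating function that vanishes for all weights over all fields belongs to a region without
tilings. -/
theorem tilingGF_one (R : Finset UnitTriangle) :
    tilingGF (1 : ℚ) 1 1 R = (lozengeTilings R).card := by
  rw [tilingGF, Finset.sum_congr rfl (g := fun _ => 1), Finset.sum_const, nsmul_eq_mul, mul_one]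
  refine fun T _ => Finset.prod_eq_one fun l _ => ?_
  cases l <;> norm_num [lozengeWeight]

theorem not_exists_isLozengeTiling_dentedTrapezoidBar (x : ℕ) {y : ℕ} (hy : 1 ≤ y) (k : ℤ)
    {W : Finset ℕ} (hW : W ⊆ Finset.Icc 1 (x + y)) (hc : W.card ≠ y) :
    ¬ ∃ T, IsLozengeTiling (dentedTrapezoidBar x y k W) T := by
  have h := tilingGF_dentedTrapezoidBar_eq_zero (1 : ℚ) 1 1 x hy k hW hc
  rw [tilingGF_one, Nat.cast_eq_zero, Finset.card_eq_zero] at h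
  rintro ⟨T, hT⟩
  rw [← mem_lozengeTilings, h] at hT
  exact Finset.notMem_empty T hT

/-! ### The product formula -/

theorem prod_filter_lt_image {α M : Type*} [LinearOrder α] [CommMonoid M] {n : ℕ} {w : Fin n → α}
    (hw : StrictMono w) (f : α × α → M) :
    ∏ p ∈ (Finset.univ.image w ×ˢ Finset.univ.image w).filter (fun p => p.1 < p.2), f p =
      ∏ i, ∏ j ∈ Finset.Ioi i, f (w i, w j) := by
  rw [← Finset.prodMap_image_product, Finset.filter_image,
    Finset.prod_image (hw.injective.prodMap hw.injective).injOn, Finset.prod_filter,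
    Finset.prod_product]
  refine Finset.prod_congr rfl fun i _ => ?_
  simp only [Prod.map_apply, hw.lt_iff_lt]
  rw [← Finset.prod_filter, Finset.filter_lt_eq_Ioi]

theorem DeltaXY_image_eq_det_vandermonde {K : Type*} [Field K] {q : K} (hq0 : q ≠ 0) (X Y : K)
    (k : ℤ) (x y : ℕ) {n : ℕ} {w : Fin n → ℕ} (hw : StrictMono w) :
    DeltaXY q X Y k x y (Finset.univ.image w) =
      (Matrix.vandermonde fun i => qSinh q X Y (2 * w i + (k - (x + y + 1)))).det := by
  rw [DeltaXY, prod_filter_lt_image hw, Matrix.det_vandermonde]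
  refine Finset.prod_congr rfl fun i _ => Finset.prod_congr rfl fun j _ => ?_
  have h := qSinh_add_sub_qSinh_sub hq0 X Y (w i + w j + k - (x + y + 1)) (w j - w i)
  rw [qCosh] at h
  rw [← h]
  congr 2 <;> ring

theorem Delta_image_sideLabel {K : Type*} [Field K] (q : K) (x y : ℕ) {n : ℕ} {w : Fin n → ℕ}
    (hw : StrictMono w) :
    Delta q ((Finset.univ.image w).image (sideLabel x y)) =
      DeltaXY q 1 1 0 x y (Finset.univ.image w) := by
  have hw' : StrictMono (sideLabel x y ∘ w) := fun i j hij => by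
    simpa [sideLabel] using hw hij
  rw [DeltaXY, prod_filter_lt_image hw, Finset.image_image, Delta, prod_filter_lt_image hw']
  refine Finset.prod_congr rfl fun i _ => Finset.prod_congr rfl fun j _ => ?_
  have h1 : sideLabel x y (w j) + sideLabel x y (w i) =
      (((w i : ℤ) + w j + 0 - (x + y + 1) : ℤ) : ℚ) := by
    simp only [sideLabel]
    push_cast
    ring
  have h2 : sideLabel x y (w j) - sideLabel x y (w i) = (((w j : ℤ) - w i : ℤ) : ℚ) := by
    simp only [sideLabel]
    push_cast
    ring
  simp only [Function.comp_apply]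
  rw [h1, h2, Int.floor_intCast, Int.floor_intCast, qPlus, one_mul, one_mul]

/-- Both sides obey the same branching rule, so the generating function and the Vandermonde
determinant agree up to the `q`-factorials that the latter picks up in each step. -/
theorem tilingGF_mul_prod_qFact_eq_det_vandermonde {K : Type*} [Field K] {q : K} (hq0 : q ≠ 0)
    (X Y : K) (x n : ℕ) (k : ℤ) (hq : 1 ≤ n → q - q⁻¹ ≠ 0) {w : Fin (n + 1) → ℕ}
    (hw : StrictMono w) (hwN : Finset.univ.image w ⊆ Finset.Icc 1 (x + (n + 1))) :
    tilingGF q X Y (dentedTrapezoidBar x (n + 1) k (Finset.univ.image w)) *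
        ∏ i ∈ Finset.Icc 1 n, qFact q i =
      (Matrix.vandermonde fun i =>
        qSinh q X Y (2 * w i + (k - (x + (n + 1 : ℕ) + 1)))).det := by
  induction n with
  | zero =>
    rw [tilingGF_dentedTrapezoidBar_one q X Y x k hwN, if_pos (by simp)]
    simp
  | succ n ih =>
    have hq' := hq (Nat.le_add_left _ _)
    have he : k - ((x : ℤ) + (n + 1 + 1 : ℕ) + 1) + 1 = k - (x + (n + 1 : ℕ) + 1) := by
      push_cast
      ring
    classical
    rw [tilingGF_dentedTrapezoidBar_succ q X Y x (Nat.le_add_left _ _) k hwN,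
      sum_interlaces_eq_sum_piFinset (N := x + (n + 1)) hw hwN,
      det_vandermonde_qSinh_eq_sum hq0 hq' X Y _ w hw.monotone, he, Finset.sum_mul]
    refine Finset.sum_congr rfl fun u hu => ?_
    simp only [Fintype.mem_piFinset, Finset.mem_Ico] at hu
    have hmono := strictMono_of_mem_piFinset_Ico hw hu
    have huN : Finset.univ.image u ⊆ Finset.Icc 1 (x + (n + 1)) := by
      intro m hm
      obtain ⟨i, -, rfl⟩ := Finset.mem_image.1 hm
      have h1 := Finset.mem_Icc.1 (hwN (Finset.mem_image_of_mem w (Finset.mem_univ i.castSucc)))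
      have h2 := Finset.mem_Icc.1 (hwN (Finset.mem_image_of_mem w (Finset.mem_univ i.succ)))
      have h3 := hu i
      rw [Finset.mem_Icc]
      omega
    rw [← ih (fun _ => hq') hmono huN, Finset.prod_image hmono.injective.injOn,
      Finset.prod_Icc_succ_top (Nat.le_add_left _ _)]
    have hc (i : Fin (n + 1)) : segmentCentre k (x + (n + 1)) (u i) =
        2 * u i + (k - (x + (n + 1 : ℕ) + 1)) := by
      rw [segmentCentre]
      push_cast
      ring
    simp only [hc]
    ring

theorem tilingGF_empty {K : Type*} [Field K] (q X Y : K) : tilingGF q X Y ∅ = 1 := by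
  have h : lozengeTilings ∅ = {∅} := by
    ext T
    rw [mem_lozengeTilings, Finset.mem_singleton, isLozengeTiling_iff]
    constructor
    · intro hT
      refine Finset.eq_empty_of_forall_notMem fun l hl => ?_
      exact Finset.notMem_empty _ (hT.1 l hl _ (Lozenge.mem_triangles.2 (.inl rfl)))
    · rintro rfl
      simp
  rw [tilingGF, h, Finset.sum_singleton, Finset.prod_empty]

theorem tilingGF_dentedTrapezoidBar {K : Type*} [Field K] (x y : ℕ) {q : K} (hq0 : q ≠ 0)
    (hq : ∀ i ∈ Finset.Icc 1 (y - 1), q ^ (2 * i) ≠ 1) (X Y : K) (k : ℤ) {W : Finset ℕ}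
    (hW : W ⊆ Finset.Icc 1 (x + y)) (hc : W.card = y) :
    tilingGF q X Y (dentedTrapezoidBar x y k W) =
      DeltaXY q X Y k x y W / ∏ i ∈ Finset.Icc 1 (y - 1), qFact q i := by
  rcases y with _ | n
  · obtain rfl := Finset.card_eq_zero.1 hc
    have h0 : dentedTrapezoidBar x 0 k ∅ = ∅ := by
      simp [dentedTrapezoidBar, dentedTrapezoid, trapezoid]
    rw [h0, tilingGF_empty]
    simp [DeltaXY]
  · rw [Nat.add_sub_cancel] at hq ⊢
    have hqq (h : 1 ≤ n) : q - q⁻¹ ≠ 0 := by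
      intro h'
      refine hq 1 (Finset.mem_Icc.2 ⟨le_rfl, h⟩) ?_
      rw [mul_one, sq]
      nth_rewrite 2 [sub_eq_zero.1 h']
      exact mul_inv_cancel₀ hq0
    obtain ⟨w, hw, rfl⟩ : ∃ w : Fin (n + 1) → ℕ, StrictMono w ∧ Finset.univ.image w = W :=
      ⟨W.orderEmbOfFin hc, (W.orderEmbOfFin hc).strictMono, Finset.image_orderEmbOfFin_univ W hc⟩
    rw [eq_div_iff, tilingGF_mul_prod_qFact_eq_det_vandermonde hq0 X Y x n k hqq hw hW,
      DeltaXY_image_eq_det_vandermonde hq0 X Y k x (n + 1) hw]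
    refine Finset.prod_ne_zero_iff.2 fun i hi => Finset.prod_ne_zero_iff.2 fun m hm => ?_
    rw [Finset.mem_Icc] at hi hm
    exact qInt_ne_zero hq0 (hqq (hi.1.trans hi.2))
      (hq m (Finset.mem_Icc.2 ⟨hm.1, hm.2.trans hi.2⟩))

theorem theoremA1 {K : Type*} [Field K] (h2 : (2 : K) ≠ 0) (x y : ℕ) (q : K) (hq0 : q ≠ 0)
    (hq : ∀ i ∈ Finset.Icc 1 (y - 1), q ^ (2 * i) ≠ 1) :
    (∀ (X Y : K) (k : ℤ) (W : Finset ℕ), W ⊆ Finset.Icc 1 (x + y) →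
      (y ≠ 0 → W.card ≠ y →
        (¬ ∃ T, IsLozengeTiling (dentedTrapezoidBar x y k W) T) ∧
          tilingGF q X Y (dentedTrapezoidBar x y k W) = 0) ∧
      (W.card = y →
        tilingGF q X Y (dentedTrapezoidBar x y k W) =
          DeltaXY q X Y k x y W / ∏ i ∈ Finset.Icc 1 (y - 1), qFact q i)) ∧
    (∀ Z : Finset ℚ, Z ⊆ sideLabels x y →
      (y ≠ 0 → Z.card ≠ y →
        (¬ ∃ T, IsLozengeTiling (dentedTrapezoid x y 0 Z) T) ∧
          tilingGF q 1 1 (dentedTrapezoid x y 0 Z) = 0) ∧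
      (Z.card = y →
        tilingGF q 1 1 (dentedTrapezoid x y 0 Z) =
          Delta q Z / ∏ i ∈ Finset.Icc 1 (y - 1), qFact q i)) := by
  constructor
  · intro X Y k W hW
    exact ⟨fun hy hc =>
      ⟨not_exists_isLozengeTiling_dentedTrapezoidBar x (Nat.one_le_iff_ne_zero.2 hy) k hW hc,
        tilingGF_dentedTrapezoidBar_eq_zero q X Y x (Nat.one_le_iff_ne_zero.2 hy) k hW hc⟩,
      tilingGF_dentedTrapezoidBar x y hq0 hq X Y k hW⟩
  · intro Z hZ
    obtain ⟨W, hW, rfl⟩ := Finset.subset_image_iff.1 hZ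
    rw [Finset.card_image_of_injective _ (sideLabel_injective x y)]
    refine ⟨fun hy hc =>
      ⟨not_exists_isLozengeTiling_dentedTrapezoidBar x (Nat.one_le_iff_ne_zero.2 hy) 0 hW hc,
        tilingGF_dentedTrapezoidBar_eq_zero q 1 1 x (Nat.one_le_iff_ne_zero.2 hy) 0 hW hc⟩,
      fun hc => ?_⟩
    have hD : Delta q (W.image (sideLabel x y)) = DeltaXY q 1 1 0 x y W := by
      have h := Delta_image_sideLabel q x y (W.orderEmbOfFin hc).strictMono
      rwa [Finset.image_orderEmbOfFin_univ W hc] at h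
    rw [hD]
    exact tilingGF_dentedTrapezoidBar x y hq0 hq 1 1 0 hW hc
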